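/- A composition of $n$ is a sequence $(x_1,\dots,x_m)$ of positive integers with $x_1+\dots+x_m=n$. It contains the pattern $\pi\in S_3$ if there are $i_1<i_2<i_3$ such that, for all $a,b\in\{1,2,3\}$, $x_{i_a}<x_{i_b}$ if and only if $\pi(a)<\pi(b)$; otherwise it avoids $\pi$. For $\pi\in S_3$ let $c(n,k)$ be the number of $\pi$-avoiding compositions of $n$ all of whose parts are at most $k$. Let $r=\frac{1+\sqrt5}{2}$ and $s=\frac{1-\sqrt5}{2}$. Then for every $\pi\in S_3$ and every fixed $k\ge 2$, $$c(n,k)\sim K(k)\left(\frac{1+\sqrt5}{2}\right)^n\qquad(n\to\infty),$$ where $$K(k)=\frac{r}{(r-1)(r-s)}\left(r\prod_{j=3}^{k}\frac{1-\frac1r}{\left(1-r^{1-j}\right)\left(1-\frac1r-r^{-j}\right)}-\prod_{j=3}^{k}\frac{1-r^{-2}}{\left(1-r^{2-j}\right)\left(1-r^{-2}-r^{-j}\right)}\right)$$ (empty products are $1$). Moreover, $x=\frac{2}{1+\sqrt5}$ is a root of $x+x^2=1$, and among all complex roots of all the equations $x^i+x^j=1$ with integers $1\le i<j$ it has the smallest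 modulus: every such root $z$ satisfies $|z|\ge\frac{2}{1+\sqrt5}$, with equality only if $(i,j)=(1,2)$ and $z=\frac{2}{1+\sqrt5}$. -/

import Mathlib

/-- The composition `c` contains the three-letter pattern `π`, given as the word `π 0, π 1, π 2`:
some three parts, read from left to right, are in the same strict relative order as the letters
of `π`. -/
def CompositionContains {n : ℕ} (π : Equiv.Perm (Fin 3)) (c : Composition n) : Prop :=
  ∃ f : Fin 3 → Fin c.length, StrictMono f ∧
    ∀ a b : Fin 3, c.blocksFun (f a) < c.blocksFun (f b) ↔ π a < π b

/-- The compositions of `n` into positive parts, all of them at most `k`, that avoid `π`. -/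
def avoidingCompositions (π : Equiv.Perm (Fin 3)) (n k : ℕ) : Set (Composition n) :=
  {c | (∀ b ∈ c.blocks, b ≤ k) ∧ ¬ CompositionContains π c}

/-- The number `c(n, k)` of `π`-avoiding compositions of `n` into positive parts that are at
most `k`. -/
noncomputable def avoidingCount (π : Equiv.Perm (Fin 3)) (n k : ℕ) : ℕ :=
  (avoidingCompositions π n k).ncard

/-- The constant `K(k)`, for `r = (1 + √5) / 2` and `s = (1 - √5) / 2`; the exponents are
integers. -/
noncomputable def growthConstant (k : ℕ) : ℝ :=
  let r : ℝ := (1 + √5) / 2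
  let s : ℝ := (1 - √5) / 2
  r / ((r - 1) * (r - s)) *
    (r * ∏ j ∈ Finset.Icc 3 k,
        (1 - 1 / r) / ((1 - r ^ (1 - (j : ℤ))) * (1 - 1 / r - r ^ (-(j : ℤ))))
      - ∏ j ∈ Finset.Icc 3 k,
        (1 - r ^ (-2 : ℤ)) /
          ((1 - r ^ (2 - (j : ℤ))) * (1 - r ^ (-2 : ℤ) - r ^ (-(j : ℤ)))))

/-! Write `x_a` for the series `X ^ e a` of the letter `a`, and let `Φ l` be the generating function
of the avoiding words whose letters have the weights listed in `l`. For the patterns 123 and 213,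
comparing words with two, or only one, of the two largest letters gives `(L z - L y) Φ(z, y, t) = L
z Φ(z, t) - L y Φ(y, t)`, with `L a = X ^ a (1 - X ^ a)` (`increasing_recurrence`,
`descentBelow_recurrence`). With the one-letter values, this is all that the rest needs
(`IsAvoidanceFamily`). It makes `Φ` symmetric in distinct weights (`IsAvoidanceFamily.perm`), so
reversal and complementation carry the two patterns to all six: complementation only reverses the
order of the weights `1, …, k`.

Since `L i - L j = X ^ i (1 - X ^ (j - i)) (1 - X ^ i - X ^ j)` for `i < j`, singularities come only
from the roots of these factors. Let `y` be the positive root of `y + y ^ 2 = 1`, and `r = 1 / y`.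
Only the pair `{1, 2}` gives a root of modulus below `13 / 20`, namely `y`; without it `Φ` converges
absolutely at `13 / 20` (`IsAvoidanceFamily.convergesAbsAt`). With it, `(1 - r X) Φ` converges there
(`IsAvoidanceFamily.dominant_part`). Its value at `y` is the limit of `c(n, k) y ^ n`. Adding a
weight `j ≥ 3` multiplies this value by an explicit factor, because the other term of the recurrence
lacks the weight 1 and is killed by `1 - r X` at `y`.

The two products in `growthConstant` agree factor by factor, by `1 - y = y ^ 2`, which leaves a
single product (`growthConstant_eq`). The claim about roots is the triangle inequality
(`root_modulus`). -/

open PowerSeries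

/-! ### Generating functions of weighted words -/

/-- The words of weight `n` over the letters `0, …, K - 1` that satisfy `P`, when the letter `a`
has weight `e a`. -/
def weightedWords (K : ℕ) (e : ℕ → ℕ) (P : List ℕ → Prop) (n : ℕ) : Set (List ℕ) :=
  {u | (∀ a ∈ u, a < K) ∧ (u.map e).sum = n ∧ P u}

theorem weightedWords_eq (K : ℕ) (e : ℕ → ℕ) (P : List ℕ → Prop) (n : ℕ) :
    weightedWords K e P n = {u | u = [] ∧ n = 0 ∧ P []} ∪
      ⋃ a ∈ Finset.range K, {u | ∃ v, u = a :: v ∧ e a ≤ n ∧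
        v ∈ weightedWords K e (fun v => P (a :: v)) (n - e a)} := by
  ext u
  cases u with
  | nil => simp [weightedWords, eq_comm]
  | cons a v =>
    simp only [weightedWords, Set.mem_ofPred_eq, List.mem_cons, forall_eq_or_imp, List.map_cons,
      List.sum_cons, Set.mem_union, reduceCtorEq, false_and, false_or, Set.mem_iUnion,
      Finset.mem_range, List.cons.injEq, exists_prop]
    constructor
    · rintro ⟨⟨h1, h2⟩, h3, h4⟩
      exact ⟨a, h1, v, ⟨rfl, rfl⟩, by omega, h2, by omega, h4⟩
    · rintro ⟨b, h1, w, ⟨rfl, rfl⟩, h2, h3, h4, h5⟩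
      exact ⟨⟨h1, h3⟩, by omega, h5⟩

theorem cons_weightedWords_eq (K : ℕ) (e : ℕ → ℕ) (P : List ℕ → Prop) (n a : ℕ) :
    {u | ∃ v, u = a :: v ∧ e a ≤ n ∧ v ∈ weightedWords K e P (n - e a)} =
      if e a ≤ n then List.cons a '' weightedWords K e P (n - e a) else ∅ := by
  split_ifs with h
  · ext u
    simp only [h, true_and, Set.mem_ofPred_eq, Set.mem_image]
    exact ⟨fun ⟨v, h1, h2⟩ => ⟨v, h2, h1.symm⟩, fun ⟨v, h1, h2⟩ => ⟨v, h2.symm, h1⟩⟩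
  · simp [h]

theorem finite_weightedWords {K : ℕ} {e : ℕ → ℕ} (he : ∀ a < K, 0 < e a) (n : ℕ)
    (P : List ℕ → Prop) : (weightedWords K e P n).Finite := by
  induction n using Nat.strong_induction_on generalizing P with
  | _ n ih =>
    rw [weightedWords_eq]
    refine Set.Finite.union ((Set.finite_singleton []).subset fun u hu => hu.1) ?_
    refine Set.Finite.biUnion (Finset.finite_toSet _) fun a ha => ?_
    rw [cons_weightedWords_eq]
    split_ifs with h
    · have := he a (by simpa using ha)
      exact (ih (n - e a) (by omega) _).image _
    · exact Set.finite_empty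

/-- The generating function, by weight, of the words over `0, …, K - 1` that satisfy `P`. -/
noncomputable def wordSeries (K : ℕ) (e : ℕ → ℕ) (P : List ℕ → Prop) : ℝ⟦X⟧ :=
  PowerSeries.mk fun n => ((weightedWords K e P n).ncard : ℝ)

open Classical in
theorem wordSeries_eq {K : ℕ} {e : ℕ → ℕ} (he : ∀ a < K, 0 < e a) (P : List ℕ → Prop) :
    wordSeries K e P = (if P [] then 1 else 0) +
      ∑ a ∈ Finset.range K, X ^ e a * wordSeries K e (fun u => P (a :: u)) := by
  ext n
  simp only [wordSeries, coeff_mk, map_add, map_sum, coeff_X_pow_mul']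
  rw [weightedWords_eq, Set.ncard_union_eq ?_ ?_ ?_]
  · rw [Nat.cast_add]
    congr 1
    · by_cases h : P []
      · by_cases hn : n = 0
        · simp [h, hn]
        · simp [h, hn, coeff_one]
      · simp [h]
    · have hS : ∀ a ∈ Finset.range K, ((({u | ∃ v, u = a :: v ∧ e a ≤ n ∧
          v ∈ weightedWords K e (fun v => P (a :: v)) (n - e a)} : Set (List ℕ)).ncard : ℕ) : ℝ) =
          if e a ≤ n then
            ((weightedWords K e (fun v => P (a :: v)) (n - e a)).ncard : ℝ) else 0 := by
        intro a ha
        rw [cons_weightedWords_eq]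
        split_ifs with h
        · rw [Set.ncard_image_of_injective _ (List.cons_injective)]
        · simp
      rw [← Finset.sum_congr rfl hS]
      have := Set.Finite.ncard_biUnion (t := (Finset.range K : Set ℕ)) (Finset.finite_toSet _)
        (s := fun a => {u | ∃ v, u = a :: v ∧ e a ≤ n ∧
          v ∈ weightedWords K e (fun v => P (a :: v)) (n - e a)}) ?_ ?_
      · rw [finsum_mem_coe_finset] at this
        rw [← Nat.cast_sum]
        exact_mod_cast this
      · intro a ha
        rw [cons_weightedWords_eq]
        split_ifs
        · exact (finite_weightedWords he _ _).image _
        · exact Set.finite_empty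
      · intro a _ b _ hab
        refine Set.disjoint_left.2 ?_
        rintro u ⟨v, rfl, _⟩ ⟨w, hw, _⟩
        exact hab (List.cons.inj hw).1
  · refine Set.disjoint_left.2 ?_
    rintro u ⟨rfl, _⟩ hu
    simp at hu
  · exact (Set.finite_singleton []).subset fun u hu => hu.1
  · refine (finite_weightedWords he n P).subset ?_
    rw [weightedWords_eq K e P n]
    exact Set.subset_union_right

theorem wordSeries_congr {K : ℕ} {e e' : ℕ → ℕ} {P Q : List ℕ → Prop}
    (hee : ∀ a < K, e a = e' a) (h : ∀ u : List ℕ, (∀ a ∈ u, a < K) → (P u ↔ Q u)) :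
    wordSeries K e P = wordSeries K e' Q := by
  ext n
  simp only [wordSeries, coeff_mk]
  congr 2
  ext u
  simp only [weightedWords, Set.mem_ofPred_eq]
  refine and_congr_right fun hu => ?_
  rw [h u hu, List.map_congr_left fun a ha => hee a (hu a ha)]

/-- A condition that bans the top letter shrinks the alphabet. This is how series over `k + 1`
letters enter the recurrences for `k + 2` letters. -/
theorem wordSeries_succ_of_notMem {K : ℕ} {e : ℕ → ℕ} {P Q : List ℕ → Prop}
    (h : ∀ u : List ℕ, (∀ a ∈ u, a < K + 1) → (P u ↔ K ∉ u ∧ Q u)) :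
    wordSeries (K + 1) e P = wordSeries K e Q := by
  ext n
  simp only [wordSeries, coeff_mk]
  congr 2
  ext u
  simp only [weightedWords, Set.mem_ofPred_eq]
  constructor
  · rintro ⟨hu, hn, hP⟩
    obtain ⟨h1, h2⟩ := (h u hu).1 hP
    refine ⟨fun a ha => ?_, hn, h2⟩
    have := hu a ha
    have : a ≠ K := fun hh => h1 (hh ▸ ha)
    omega
  · rintro ⟨hu, hn, hQ⟩
    have hu' : ∀ a ∈ u, a < K + 1 := fun a ha => by have := hu a ha; omega
    exact ⟨hu', hn, (h u hu').2 ⟨fun hK => by have := hu K hK; omega, hQ⟩⟩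

theorem wordSeries_eq_zero {K : ℕ} {e : ℕ → ℕ} {P : List ℕ → Prop}
    (h : ∀ u : List ℕ, (∀ a ∈ u, a < K) → ¬ P u) : wordSeries K e P = 0 := by
  ext n
  simp only [wordSeries, coeff_mk, map_zero, Nat.cast_eq_zero]
  convert Set.ncard_empty (List ℕ)
  ext u
  simp only [weightedWords, Set.mem_ofPred_eq, Set.mem_empty_iff_false, iff_false]
  exact fun hu => h u hu.1 hu.2.2

/-- A contracting linear system of power series indexed by words has only the zero solution. -/
theorem eq_zero_of_linear_system {k : ℕ} {e : ℕ → ℕ} (he : ∀ a < k, 0 < e a)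
    {H : List ℕ → Prop} (hH : ∀ h, H h → ∀ a < k, H (h ++ [a])) {D : List ℕ → ℝ⟦X⟧}
    (hD : ∀ h, H h → ∃ q : ℝ⟦X⟧, X ∣ q ∧
      D h = q * D h + ∑ a ∈ Finset.range k, X ^ e a * D (h ++ [a])) :
    ∀ h, H h → D h = 0 := by
  -- Every coefficient of the system is divisible by `X`, so each pass through it gains one power of
  -- `X`, uniformly in `h`.
  have key : ∀ N : ℕ, ∀ h, H h → X ^ N ∣ D h := by
    intro N
    induction N with
    | zero => simp
    | succ N ih =>
      intro h hh
      obtain ⟨q, hq, hDq⟩ := hD h hh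
      rw [hDq]
      refine dvd_add ?_ (Finset.dvd_sum fun a ha => ?_)
      · rw [pow_succ']
        exact mul_dvd_mul hq (ih h hh)
      · rw [pow_succ']
        have ha := Finset.mem_range.1 ha
        exact mul_dvd_mul (dvd_pow_self _ (he a ha).ne') (ih _ (hH h hh a ha))
  intro h hh
  ext n
  exact (X_pow_dvd_iff.1 (key (n + 1) h hh)) n (Nat.lt_succ_self n)

/-! ### Deleting a letter from an avoiding word -/

/-- The word `l` has no three letters, from left to right, that satisfy `R`. -/
def WordAvoids (R : ℕ → ℕ → ℕ → Prop) (l : List ℕ) : Prop :=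
  ∀ a b c : ℕ, [a, b, c].Sublist l → ¬ R a b c

/-- The word `l` has no two letters, from left to right, that satisfy `r`. -/
def PairAvoids (r : ℕ → ℕ → Prop) (l : List ℕ) : Prop :=
  ∀ a b : ℕ, [a, b].Sublist l → ¬ r a b

theorem triple_sublist_insert {h u : List ℕ} {z a b c : ℕ} :
    [a, b, c].Sublist (h ++ z :: u) → [a, b, c].Sublist (h ++ u) ∨
      (a = z ∧ [b, c].Sublist u) ∨ (b = z ∧ a ∈ h ∧ c ∈ u) ∨ (c = z ∧ [a, b].Sublist h) := by
  intro H
  obtain ⟨l₁, l₂, hl, h1, h2⟩ := List.sublist_append_iff.1 H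
  rcases List.sublist_cons_iff.1 h2 with h2 | ⟨r, rfl, hr⟩
  · left
    rw [hl]
    exact h1.append h2
  · right
    match l₁, hl with
    | [], hl =>
      simp only [List.nil_append, List.cons.injEq] at hl
      obtain ⟨rfl, rfl⟩ := hl
      exact Or.inl ⟨rfl, hr⟩
    | [x], hl =>
      simp only [List.cons_append, List.nil_append, List.cons.injEq] at hl
      obtain ⟨rfl, rfl, rfl⟩ := hl
      exact Or.inr (Or.inl ⟨rfl, by simpa using h1, by simpa using hr⟩)
    | [x, y], hl =>
      simp only [List.cons_append, List.nil_append, List.cons.injEq] at hl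
      obtain ⟨rfl, rfl, rfl, rfl⟩ := hl
      exact Or.inr (Or.inr ⟨rfl, h1⟩)
    | x :: y :: w :: t, hl =>
      have := congrArg List.length hl
      simp at this

theorem WordAvoids.of_sublist {R : ℕ → ℕ → ℕ → Prop} {l l' : List ℕ} (h : WordAvoids R l')
    (hl : l.Sublist l') : WordAvoids R l :=
  fun a b c habc => h a b c (habc.trans hl)

theorem wordAvoids_insert {R : ℕ → ℕ → ℕ → Prop} {h u : List ℕ} {z : ℕ}
    (h1 : ∀ b c, [b, c].Sublist u → ¬ R z b c) (h2 : ∀ a ∈ h, ∀ c ∈ u, ¬ R a z c)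
    (h3 : ∀ a b, [a, b].Sublist h → ¬ R a b z) :
    WordAvoids R (h ++ z :: u) ↔ WordAvoids R (h ++ u) := by
  refine ⟨fun H => H.of_sublist ?_, fun H a b c habc => ?_⟩
  · exact (List.Sublist.refl h).append (List.sublist_cons_self z u)
  · rcases triple_sublist_insert habc with h' | ⟨rfl, h'⟩ | ⟨rfl, ha, hc⟩ | ⟨rfl, h'⟩
    · exact H a b c h'
    · exact h1 b c h'
    · exact h2 a ha c hc
    · exact h3 a b h'

/-- The pattern `123`. -/
def Increasing (a b c : ℕ) : Prop := a < b ∧ b < c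

/-- The pattern `213`. -/
def DescentBelow (a b c : ℕ) : Prop := b < a ∧ a < c

/-- Nothing after `z` exceeds it, so `z` cannot be the first or middle letter of a 123; as the last
letter it would need an ascent in `h`. -/
theorem increasing_insert_max {h u : List ℕ} {z : ℕ} (hu : ∀ a ∈ u, a ≤ z)
    (hg : PairAvoids (· < ·) h) :
    WordAvoids Increasing (h ++ z :: u) ↔ WordAvoids Increasing (h ++ u) := by
  refine wordAvoids_insert (fun b c hbc H => ?_) (fun a _ c hc H => ?_)
    (fun a b hab H => hg a b hab H.1)
  · have := hu b (hbc.subset (by simp))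
    exact absurd H.1 (by omega)
  · have := hu c hc
    exact absurd H.2 (by omega)

theorem descentBelow_insert_max {h u : List ℕ} {z : ℕ} (hh : ∀ a ∈ h, a ≤ z)
    (hu : ∀ a ∈ u, a ≤ z) (hg : PairAvoids (fun a b => b < a) h) :
    WordAvoids DescentBelow (h ++ z :: u) ↔ WordAvoids DescentBelow (h ++ u) := by
  refine wordAvoids_insert (fun b c hbc H => ?_) (fun a ha c hc H => ?_)
    (fun a b hab H => hg a b hab H.1)
  · have := hu c (hbc.subset (by simp))
    exact absurd H.2 (by omega)
  · have := hh a ha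
    exact absurd H.1 (by omega)

theorem not_wordAvoids_of_not_pairAvoids {R : ℕ → ℕ → ℕ → Prop} {r : ℕ → ℕ → Prop}
    {h u : List ℕ} {z : ℕ} (hR : ∀ a ∈ h, ∀ b ∈ h, r a b → R a b z)
    (hb : ¬ PairAvoids r h) : ¬ WordAvoids R (h ++ z :: u) := by
  intro H
  refine hb fun a b hab hr => ?_
  refine H a b z ?_ (hR a (hab.subset (by simp)) b (hab.subset (by simp)) hr)
  exact List.Sublist.append (l₁ := [a, b]) (r₁ := [z]) hab (by simp)

/-- Any letter of `h` is below `k`, so a later `k + 1` would complete a 123. Once `k + 1` is banned,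
`k` is the maximum of what follows. -/
theorem increasing_insert_second {h u : List ℕ} {k : ℕ} (hn : h ≠ []) (hh : ∀ a ∈ h, a < k)
    (hu : ∀ a ∈ u, a < k + 2) (hg : PairAvoids (· < ·) h) :
    WordAvoids Increasing (h ++ k :: u) ↔ k + 1 ∉ u ∧ WordAvoids Increasing (h ++ u) := by
  by_cases hk : k + 1 ∈ u
  · simp only [hk, not_true_eq_false, false_and, iff_false]
    intro H
    obtain ⟨a, t, rfl⟩ := List.exists_cons_of_ne_nil hn
    refine H a k (k + 1) ?_ ⟨hh a (by simp), by omega⟩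
    exact List.Sublist.append (l₁ := [a]) (r₁ := [k, k + 1]) (by simp) (by simpa using hk)
  · simp only [hk, not_false_eq_true, true_and]
    refine increasing_insert_max (fun a ha => ?_) hg
    have := hu a ha
    have : a ≠ k + 1 := fun h' => hk (h' ▸ ha)
    omega

/-- At the front, `k` would need two distinct larger letters, and there is only `k + 1`. Hence the
empty prefix has to be treated apart from the others. -/
theorem increasing_cons_second {u : List ℕ} {k : ℕ} (hu : ∀ a ∈ u, a < k + 2) :
    WordAvoids Increasing (k :: u) ↔ WordAvoids Increasing u := by
  refine wordAvoids_insert (h := []) (fun b c hbc H => ?_) (by simp) (fun a b hab => ?_)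
  · have := hu c (hbc.subset (by simp))
    exact absurd H.2 (by have := H.1; omega)
  · simp at hab

theorem pairAvoids_concat_max {h : List ℕ} {k : ℕ} (hh : ∀ a ∈ h, a ≤ k)
    (hg : PairAvoids (fun a b => b < a) h) : PairAvoids (fun a b => b < a) (h ++ [k]) := by
  intro a b hab
  obtain ⟨l₁, l₂, hl, h1, h2⟩ := List.sublist_append_iff.1 hab
  rcases List.sublist_singleton.1 h2 with rfl | rfl
  · rw [List.append_nil] at hl
    exact hg a b (hl ▸ h1)
  · obtain ⟨rfl, hb⟩ := List.append_inj' (s₁ := [a]) (t₁ := [b]) hl rfl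
    have := hh a (h1.subset (by simp))
    simp at hb
    omega

theorem descentBelow_insert_second_max {h u : List ℕ} {k : ℕ} (hh : ∀ a ∈ h, a < k)
    (hu : ∀ a ∈ u, a < k + 2) (hg : PairAvoids (fun a b => b < a) h) :
    WordAvoids DescentBelow (h ++ k :: (k + 1) :: u) ↔ WordAvoids DescentBelow (h ++ k :: u) := by
  have := descentBelow_insert_max (h := h ++ [k]) (u := u) (z := k + 1)
    (fun a ha => ?_) (fun a ha => ?_) (pairAvoids_concat_max (fun a ha => (hh a ha).le) hg)
  · simpa using this
  · rcases List.mem_append.1 ha with ha | ha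
    · have := hh a ha
      omega
    · simp at ha
      omega
  · have := hu a ha
    omega

/-- The extra `k` cannot be a middle letter, since no letter of `h` exceeds it, nor a last one,
since `h` has no descent. As a first letter, it can be replaced by its neighbour. -/
theorem descentBelow_insert_second_twice {h u : List ℕ} {k : ℕ} (hh : ∀ a ∈ h, a < k)
    (hg : PairAvoids (fun a b => b < a) h) :
    WordAvoids DescentBelow (h ++ k :: k :: u) ↔ WordAvoids DescentBelow (h ++ k :: u) := by
  refine ⟨fun H => H.of_sublist ?_, fun H a b c habc => ?_⟩
  · exact (List.Sublist.refl h).append (List.sublist_cons_self k _)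
  · rcases triple_sublist_insert habc with h' | ⟨rfl, h'⟩ | ⟨rfl, ha, hc⟩ | ⟨rfl, h'⟩
    · exact H a b c h'
    · rcases List.sublist_cons_iff.1 h' with h' | ⟨r, hr, _⟩
      · exact H a b c ((List.Sublist.cons_cons a h').trans (List.sublist_append_right h _))
      · intro H'
        have := (List.cons.inj hr).1
        exact absurd H'.1 (by omega)
    · intro H'
      have := hh a ha
      exact absurd H'.1 (by omega)
    · exact fun H' => hg a b h' H'.1

/-- The letters `k, a` form a descent below `k + 1`, which bans `k + 1` from then on; after that `k`
is a maximum and plays no part in a 213. -/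
theorem descentBelow_insert_second_lt {h u : List ℕ} {k a : ℕ} (hh : ∀ b ∈ h, b < k) (ha : a < k)
    (hu : ∀ b ∈ u, b < k + 2) (hg : PairAvoids (fun a b => b < a) h) :
    WordAvoids DescentBelow (h ++ k :: a :: u) ↔
      k + 1 ∉ u ∧ WordAvoids DescentBelow (h ++ a :: u) := by
  by_cases hk : k + 1 ∈ u
  · simp only [hk, not_true_eq_false, false_and, iff_false]
    intro H
    refine H k a (k + 1) ?_ ⟨ha, by omega⟩
    refine List.Sublist.trans ?_ (List.sublist_append_right h _)
    simpa using hk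
  · simp only [hk, not_false_eq_true, true_and]
    refine descentBelow_insert_max (fun b hb => (hh b hb).le) (fun b hb => ?_) hg
    rcases List.mem_cons.1 hb with rfl | hb
    · omega
    · have := hu b hb
      have : b ≠ k + 1 := fun h' => hk (h' ▸ hb)
      omega

/-! ### The recurrence in the two largest letters -/

/-- The series `x (1 - x)` for `x = X ^ a`. -/
noncomputable def letterSeries (a : ℕ) : ℝ⟦X⟧ := X ^ a * (1 - X ^ a)

section Recurrence

variable {k : ℕ} {e : ℕ → ℕ}

theorem sum_range_update (F : ℕ → ℝ⟦X⟧) (m : ℕ) :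
    ∑ a ∈ Finset.range k, X ^ (Function.update e k m a) * F a =
      ∑ a ∈ Finset.range k, X ^ e a * F a := by
  refine Finset.sum_congr rfl fun a ha => ?_
  rw [Function.update_of_ne (Finset.mem_range.1 ha).ne]

theorem wordSeries_append_eq {K : ℕ} (he : ∀ a < K, 0 < e a) (R : ℕ → ℕ → ℕ → Prop)
    (h : List ℕ) [Decidable (WordAvoids R h)] :
    wordSeries K e (fun u => WordAvoids R (h ++ u)) = (if WordAvoids R h then 1 else 0) +
      ∑ a ∈ Finset.range K,
        X ^ e a * wordSeries K e (fun u => WordAvoids R (h ++ [a] ++ u)) := by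
  rw [wordSeries_eq he]
  simp

theorem wordSeries_bad_eq_zero {K : ℕ} {R : ℕ → ℕ → ℕ → Prop} {r : ℕ → ℕ → Prop} {h : List ℕ}
    {z : ℕ} (hR : ∀ a ∈ h, ∀ b ∈ h, r a b → R a b z) (hb : ¬ PairAvoids r h) :
    wordSeries K e (fun u => WordAvoids R (h ++ [z] ++ u)) = 0 := by
  refine wordSeries_eq_zero fun u _ => ?_
  simpa using not_wordAvoids_of_not_pairAvoids (u := u) hR hb

-- The left side, as a function of the prefix `h`, satisfies a contracting linear system: expand
-- each series by its next letter. Letters below `k` lengthen `h`. If `h` has no ascent, then `k`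
-- and `k + 1` can be deleted; if it has one, they are forbidden.
open Classical in
theorem increasing_recurrence_of_ne_nil (he : ∀ a < k + 2, 0 < e a) {h : List ℕ}
    (hh : ∀ a ∈ h, a < k) (hn : h ≠ []) :
    (X ^ e k - X ^ e (k + 1)) *
        wordSeries (k + 2) e (fun u => WordAvoids Increasing (h ++ u)) -
      X ^ e k * wordSeries (k + 1) e (fun u => WordAvoids Increasing (h ++ u)) +
      X ^ e (k + 1) * wordSeries (k + 1) (Function.update e k (e (k + 1)))
        (fun u => WordAvoids Increasing (h ++ u)) = 0 := by
  refine eq_zero_of_linear_system (k := k) (e := e) (fun a ha => he a (by omega))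
    (H := fun h => (∀ a ∈ h, a < k) ∧ h ≠ []) ?_
    (D := fun h => (X ^ e k - X ^ e (k + 1)) *
        wordSeries (k + 2) e (fun u => WordAvoids Increasing (h ++ u)) -
      X ^ e k * wordSeries (k + 1) e (fun u => WordAvoids Increasing (h ++ u)) +
      X ^ e (k + 1) * wordSeries (k + 1) (Function.update e k (e (k + 1)))
        (fun u => WordAvoids Increasing (h ++ u))) ?_ h ⟨hh, hn⟩
  · rintro h ⟨hh, _⟩ a ha
    refine ⟨fun b hb => ?_, by simp⟩
    rcases List.mem_append.1 hb with hb | hb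
    · exact hh b hb
    · simp at hb
      omega
  rintro h ⟨hh, hn⟩
  have he' : ∀ a < k + 1, 0 < Function.update e k (e (k + 1)) a := by
    intro a ha
    by_cases hak : a = k
    · simp [hak, he (k + 1)]
    · simp [hak, he a (by omega)]
  have e1 := wordSeries_append_eq he Increasing h
  have e2 := wordSeries_append_eq (e := e) (fun a (ha : a < k + 1) => he a (by omega)) Increasing h
  have e3 := wordSeries_append_eq he' Increasing h
  rw [Finset.sum_range_succ, Finset.sum_range_succ] at e1
  rw [Finset.sum_range_succ] at e2 e3
  rw [sum_range_update (fun a => wordSeries (k + 1) (Function.update e k (e (k + 1)))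
    (fun u => WordAvoids Increasing (h ++ [a] ++ u))), Function.update_self] at e3
  have hs : ∑ a ∈ Finset.range k, X ^ e a * ((X ^ e k - X ^ e (k + 1)) *
        wordSeries (k + 2) e (fun u => WordAvoids Increasing (h ++ [a] ++ u)) -
      X ^ e k * wordSeries (k + 1) e (fun u => WordAvoids Increasing (h ++ [a] ++ u)) +
      X ^ e (k + 1) * wordSeries (k + 1) (Function.update e k (e (k + 1)))
        (fun u => WordAvoids Increasing (h ++ [a] ++ u))) =
      (X ^ e k - X ^ e (k + 1)) * ∑ a ∈ Finset.range k, X ^ e a *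
        wordSeries (k + 2) e (fun u => WordAvoids Increasing (h ++ [a] ++ u)) -
      X ^ e k * ∑ a ∈ Finset.range k, X ^ e a *
        wordSeries (k + 1) e (fun u => WordAvoids Increasing (h ++ [a] ++ u)) +
      X ^ e (k + 1) * ∑ a ∈ Finset.range k, X ^ e a *
        wordSeries (k + 1) (Function.update e k (e (k + 1)))
        (fun u => WordAvoids Increasing (h ++ [a] ++ u)) := by
    simp only [Finset.mul_sum, ← Finset.sum_sub_distrib, ← Finset.sum_add_distrib]
    exact Finset.sum_congr rfl fun a _ => by ring
  rw [hs]
  by_cases hg : PairAvoids (· < ·) h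
  · refine ⟨X ^ e (k + 1), dvd_pow_self _ (he (k + 1) (by omega)).ne', ?_⟩
    have f1 : wordSeries (k + 2) e (fun u => WordAvoids Increasing (h ++ [k] ++ u)) =
        wordSeries (k + 1) e (fun u => WordAvoids Increasing (h ++ u)) :=
      wordSeries_succ_of_notMem fun u hu => by
        simpa using increasing_insert_second hn hh hu hg
    have f2 : wordSeries (k + 2) e (fun u => WordAvoids Increasing (h ++ [k + 1] ++ u)) =
        wordSeries (k + 2) e (fun u => WordAvoids Increasing (h ++ u)) :=
      wordSeries_congr (fun _ _ => rfl) fun u hu => by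
        simpa using increasing_insert_max (z := k + 1)
          (fun a ha => by have := hu a ha; omega) hg
    have f3 : ∀ e', wordSeries (k + 1) e' (fun u => WordAvoids Increasing (h ++ [k] ++ u)) =
        wordSeries (k + 1) e' (fun u => WordAvoids Increasing (h ++ u)) := fun e' =>
      wordSeries_congr (fun _ _ => rfl) fun u hu => by
        simpa using increasing_insert_max (z := k)
          (fun a ha => by have := hu a ha; omega) hg
    rw [f1, f2] at e1
    rw [f3] at e2 e3
    linear_combination (X ^ e k - X ^ e (k + 1)) * e1 - X ^ e k * e2 + X ^ e (k + 1) * e3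
  · refine ⟨0, dvd_zero _, ?_⟩
    have f : ∀ K e' z, k ≤ z →
        wordSeries K e' (fun u => WordAvoids Increasing (h ++ [z] ++ u)) = 0 := fun K e' z hz =>
      wordSeries_bad_eq_zero (r := (· < ·)) (fun a _ b hb hab => ⟨hab, by
        have := hh b hb
        omega⟩) hg
    rw [f _ _ _ le_rfl, f _ _ _ (Nat.le_succ k)] at e1
    rw [f _ _ _ le_rfl] at e2 e3
    linear_combination (X ^ e k - X ^ e (k + 1)) * e1 - X ^ e k * e2 + X ^ e (k + 1) * e3

/-- Updating the weight at `k` to `e (k + 1)` encodes the words that omit `k` and keep `k + 1`, the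
latter being renamed `k`. The one-letter prefixes are covered by the previous lemma. At the empty
prefix, deleting `k` bans nothing, which turns the coefficients `x_k`, `x_(k+1)` into
`letterSeries`. -/
theorem increasing_recurrence (he : ∀ a < k + 2, 0 < e a) :
    (letterSeries (e k) - letterSeries (e (k + 1))) *
        wordSeries (k + 2) e (WordAvoids Increasing) =
      letterSeries (e k) * wordSeries (k + 1) e (WordAvoids Increasing) -
      letterSeries (e (k + 1)) * wordSeries (k + 1) (Function.update e k (e (k + 1)))
        (WordAvoids Increasing) := by
  classical
  have he' : ∀ a < k + 1, 0 < Function.update e k (e (k + 1)) a := by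
    intro a ha
    by_cases hak : a = k
    · simp [hak, he (k + 1)]
    · simp [hak, he a (by omega)]
  have hnil : WordAvoids Increasing [] := fun a b c h => by simp at h
  have e1 := wordSeries_append_eq he Increasing []
  have e2 := wordSeries_append_eq (e := e) (fun a (ha : a < k + 1) => he a (by omega)) Increasing []
  have e3 := wordSeries_append_eq he' Increasing []
  rw [Finset.sum_range_succ, Finset.sum_range_succ] at e1
  rw [Finset.sum_range_succ] at e2 e3
  rw [sum_range_update (fun a => wordSeries (k + 1) (Function.update e k (e (k + 1)))
    (fun u => WordAvoids Increasing ([] ++ [a] ++ u))), Function.update_self] at e3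
  have hs : (X ^ e k - X ^ e (k + 1)) * ∑ a ∈ Finset.range k, X ^ e a *
        wordSeries (k + 2) e (fun u => WordAvoids Increasing ([a] ++ u)) -
      X ^ e k * ∑ a ∈ Finset.range k, X ^ e a *
        wordSeries (k + 1) e (fun u => WordAvoids Increasing ([a] ++ u)) +
      X ^ e (k + 1) * ∑ a ∈ Finset.range k, X ^ e a *
        wordSeries (k + 1) (Function.update e k (e (k + 1)))
        (fun u => WordAvoids Increasing ([a] ++ u)) = 0 := by
    simp only [Finset.mul_sum, ← Finset.sum_sub_distrib, ← Finset.sum_add_distrib]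
    refine Finset.sum_eq_zero fun a ha => ?_
    linear_combination X ^ e a * increasing_recurrence_of_ne_nil he (h := [a])
      (by simpa using ha) (by simp)
  have hg : PairAvoids (· < ·) ([] : List ℕ) := fun a b h => by simp at h
  have f1 : wordSeries (k + 2) e (fun u => WordAvoids Increasing ([] ++ [k] ++ u)) =
      wordSeries (k + 2) e (WordAvoids Increasing) :=
    wordSeries_congr (fun _ _ => rfl) fun u hu => by simpa using increasing_cons_second hu
  have f2 : ∀ K e', wordSeries (K + 1) e' (fun u => WordAvoids Increasing ([] ++ [K] ++ u)) =
      wordSeries (K + 1) e' (WordAvoids Increasing) := fun K e' =>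
    wordSeries_congr (fun _ _ => rfl) fun u hu => by
      simpa using increasing_insert_max (z := K) (h := [])
        (fun a ha => by have := hu a ha; omega) hg
  rw [f1, f2 (k + 1)] at e1
  rw [f2] at e2 e3
  simp only [List.nil_append, if_pos hnil] at e1 e2 e3
  unfold letterSeries
  linear_combination (X ^ e k - X ^ e (k + 1)) * e1 - X ^ e k * e2 + X ^ e (k + 1) * e3 + hs

-- The same contraction as for 123, but here the empty prefix needs no separate treatment and
-- `letterSeries` is the coefficient throughout.
open Classical in
theorem descentBelow_recurrence_append (he : ∀ a < k + 2, 0 < e a) {h : List ℕ}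
    (hh : ∀ a ∈ h, a < k) :
    (letterSeries (e k) - letterSeries (e (k + 1))) *
        wordSeries (k + 2) e (fun u => WordAvoids DescentBelow (h ++ u)) -
      letterSeries (e k) * wordSeries (k + 1) e (fun u => WordAvoids DescentBelow (h ++ u)) +
      letterSeries (e (k + 1)) * wordSeries (k + 1) (Function.update e k (e (k + 1)))
        (fun u => WordAvoids DescentBelow (h ++ u)) = 0 := by
  refine eq_zero_of_linear_system (k := k) (e := e) (fun a ha => he a (by omega))
    (H := fun h => ∀ a ∈ h, a < k) ?_
    (D := fun h => (letterSeries (e k) - letterSeries (e (k + 1))) *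
        wordSeries (k + 2) e (fun u => WordAvoids DescentBelow (h ++ u)) -
      letterSeries (e k) * wordSeries (k + 1) e (fun u => WordAvoids DescentBelow (h ++ u)) +
      letterSeries (e (k + 1)) * wordSeries (k + 1) (Function.update e k (e (k + 1)))
        (fun u => WordAvoids DescentBelow (h ++ u))) ?_ h hh
  · intro h hh a ha b hb
    rcases List.mem_append.1 hb with hb | hb
    · exact hh b hb
    · simp at hb
      omega
  intro h hh
  have he' : ∀ a < k + 1, 0 < Function.update e k (e (k + 1)) a := by
    intro a ha
    by_cases hak : a = k
    · simp [hak, he (k + 1)]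
    · simp [hak, he a (by omega)]
  have e1 := wordSeries_append_eq he DescentBelow h
  have e2 := wordSeries_append_eq (e := e) (fun a (ha : a < k + 1) => he a (by omega))
    DescentBelow h
  have e3 := wordSeries_append_eq he' DescentBelow h
  rw [Finset.sum_range_succ, Finset.sum_range_succ] at e1
  rw [Finset.sum_range_succ] at e2 e3
  rw [sum_range_update (fun a => wordSeries (k + 1) (Function.update e k (e (k + 1)))
    (fun u => WordAvoids DescentBelow (h ++ [a] ++ u))), Function.update_self] at e3
  have hs : ∑ a ∈ Finset.range k, X ^ e a * ((letterSeries (e k) - letterSeries (e (k + 1))) *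
        wordSeries (k + 2) e (fun u => WordAvoids DescentBelow (h ++ [a] ++ u)) -
      letterSeries (e k) * wordSeries (k + 1) e
        (fun u => WordAvoids DescentBelow (h ++ [a] ++ u)) +
      letterSeries (e (k + 1)) * wordSeries (k + 1) (Function.update e k (e (k + 1)))
        (fun u => WordAvoids DescentBelow (h ++ [a] ++ u))) =
      (letterSeries (e k) - letterSeries (e (k + 1))) * ∑ a ∈ Finset.range k, X ^ e a *
        wordSeries (k + 2) e (fun u => WordAvoids DescentBelow (h ++ [a] ++ u)) -
      letterSeries (e k) * ∑ a ∈ Finset.range k, X ^ e a *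
        wordSeries (k + 1) e (fun u => WordAvoids DescentBelow (h ++ [a] ++ u)) +
      letterSeries (e (k + 1)) * ∑ a ∈ Finset.range k, X ^ e a *
        wordSeries (k + 1) (Function.update e k (e (k + 1)))
        (fun u => WordAvoids DescentBelow (h ++ [a] ++ u)) := by
    simp only [Finset.mul_sum, ← Finset.sum_sub_distrib, ← Finset.sum_add_distrib]
    exact Finset.sum_congr rfl fun a _ => by ring
  rw [hs]
  by_cases hg : PairAvoids (fun a b => b < a) h
  · refine ⟨X ^ e (k + 1), dvd_pow_self _ (he (k + 1) (by omega)).ne', ?_⟩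
    have f2 : wordSeries (k + 2) e (fun u => WordAvoids DescentBelow (h ++ [k + 1] ++ u)) =
        wordSeries (k + 2) e (fun u => WordAvoids DescentBelow (h ++ u)) :=
      wordSeries_congr (fun _ _ => rfl) fun u hu => by
        simpa using descentBelow_insert_max (z := k + 1)
          (fun a ha => by have := hh a ha; omega) (fun a ha => by have := hu a ha; omega) hg
    have f3 : ∀ e', wordSeries (k + 1) e' (fun u => WordAvoids DescentBelow (h ++ [k] ++ u)) =
        wordSeries (k + 1) e' (fun u => WordAvoids DescentBelow (h ++ u)) := fun e' =>
      wordSeries_congr (fun _ _ => rfl) fun u hu => by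
        simpa using descentBelow_insert_max (z := k)
          (fun a ha => (hh a ha).le) (fun a ha => by have := hu a ha; omega) hg
    -- A `k` after `h` cannot be deleted at once, since what it bans depends on the next letter; so
    -- expand once more. Subtracting `e2` then eliminates the sum over `a < k` and gives `(1 - x_k -
    -- x_(k+1)) F(h k) = (1 - x_k) F(h)`, with `k + 2` letters on the left and `k + 1` on the right.
    -- The factor `1 - x_k - x_(k+1)` is the one in `L (e k) - L (e (k + 1)) = (x_k - x_(k+1)) (1 -
    -- x_k - x_(k+1))`.
    have e4 := wordSeries_append_eq he DescentBelow (h ++ [k])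
    rw [Finset.sum_range_succ, Finset.sum_range_succ] at e4
    have f4 : wordSeries (k + 2) e (fun u => WordAvoids DescentBelow (h ++ [k] ++ [k] ++ u)) =
        wordSeries (k + 2) e (fun u => WordAvoids DescentBelow (h ++ [k] ++ u)) :=
      wordSeries_congr (fun _ _ => rfl) fun u hu => by
        simpa using descentBelow_insert_second_twice hh hg
    have f5 : wordSeries (k + 2) e
          (fun u => WordAvoids DescentBelow (h ++ [k] ++ [k + 1] ++ u)) =
        wordSeries (k + 2) e (fun u => WordAvoids DescentBelow (h ++ [k] ++ u)) :=
      wordSeries_congr (fun _ _ => rfl) fun u hu => by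
        simpa using descentBelow_insert_second_max hh hu hg
    have f6 : ∀ a ∈ Finset.range k, X ^ e a * wordSeries (k + 2) e
          (fun u => WordAvoids DescentBelow (h ++ [k] ++ [a] ++ u)) =
        X ^ e a * wordSeries (k + 1) e (fun u => WordAvoids DescentBelow (h ++ [a] ++ u)) := by
      intro a ha
      congr 1
      refine wordSeries_succ_of_notMem fun u hu => ?_
      simpa using descentBelow_insert_second_lt hh (Finset.mem_range.1 ha) hu hg
    have f7 : WordAvoids DescentBelow (h ++ [k]) ↔ WordAvoids DescentBelow h := by
      simpa using descentBelow_insert_max (z := k) (u := []) (fun a ha => (hh a ha).le)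
        (by simp) hg
    rw [Finset.sum_congr rfl f6, f4, f5] at e4
    simp only [f7] at e4
    rw [f2] at e1
    rw [f3] at e2 e3
    unfold letterSeries
    linear_combination (X ^ e k * (1 - X ^ e k) - X ^ e (k + 1) * (1 - X ^ e (k + 1))) * e1 -
      X ^ e k * (1 - X ^ e k) * e2 + X ^ e (k + 1) * (1 - X ^ e (k + 1)) * e3 +
      X ^ e k * (X ^ e k - X ^ e (k + 1)) * (e4 - e2)
  · refine ⟨0, dvd_zero _, ?_⟩
    have f : ∀ K e' z, k ≤ z →
        wordSeries K e' (fun u => WordAvoids DescentBelow (h ++ [z] ++ u)) = 0 := fun K e' z hz =>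
      wordSeries_bad_eq_zero (r := fun a b => b < a) (fun a ha b _ hab => ⟨hab, by
        have := hh a ha
        omega⟩) hg
    rw [f _ _ _ le_rfl, f _ _ _ (Nat.le_succ k)] at e1
    rw [f _ _ _ le_rfl] at e2 e3
    linear_combination (letterSeries (e k) - letterSeries (e (k + 1))) * e1 -
      letterSeries (e k) * e2 + letterSeries (e (k + 1)) * e3

theorem descentBelow_recurrence (he : ∀ a < k + 2, 0 < e a) :
    (letterSeries (e k) - letterSeries (e (k + 1))) *
        wordSeries (k + 2) e (WordAvoids DescentBelow) =
      letterSeries (e k) * wordSeries (k + 1) e (WordAvoids DescentBelow) -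
      letterSeries (e (k + 1)) * wordSeries (k + 1) (Function.update e k (e (k + 1)))
        (WordAvoids DescentBelow) := by
  have := descentBelow_recurrence_append he (h := []) (by simp)
  simp only [List.nil_append] at this
  linear_combination this

end Recurrence

/-! ### Symmetry in the weights -/

theorem letterSeries_sub (a d : ℕ) :
    letterSeries a - letterSeries (a + d) = X ^ a * ((1 - X ^ d) * (1 - X ^ a - X ^ (a + d))) := by
  unfold letterSeries
  ring

theorem one_sub_X_pow_ne_zero {d : ℕ} (hd : 0 < d) : (1 - X ^ d : ℝ⟦X⟧) ≠ 0 := by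
  intro h
  have := congrArg constantCoeff h
  simp [hd.ne'] at this

theorem one_sub_X_pow_sub_X_pow_ne_zero {i j : ℕ} (hi : 0 < i) (hj : 0 < j) :
    (1 - X ^ i - X ^ j : ℝ⟦X⟧) ≠ 0 := by
  intro h
  have := congrArg constantCoeff h
  simp [hi.ne', hj.ne'] at this

theorem letterSeries_sub_ne_zero {a b : ℕ} (ha : 0 < a) (hb : 0 < b) (hab : a ≠ b) :
    letterSeries a - letterSeries b ≠ 0 := by
  wlog h : a < b generalizing a b
  · rw [← neg_ne_zero, neg_sub]
    exact this hb ha hab.symm (by omega)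
  obtain ⟨d, rfl⟩ := Nat.exists_eq_add_of_lt h
  rw [add_assoc, letterSeries_sub]
  exact mul_ne_zero (pow_ne_zero _ X_ne_zero) (mul_ne_zero (one_sub_X_pow_ne_zero (by omega))
    (one_sub_X_pow_sub_X_pow_ne_zero ha (by omega)))

/-- A family of power series, indexed by lists of exponents, with the initial values and the
recurrence of the generating functions of words that avoid a pattern. -/
structure IsAvoidanceFamily (Φ : List ℕ → ℝ⟦X⟧) : Prop where
  single : ∀ a, 0 < a → (1 - X ^ a) * Φ [a] = 1
  recurrence : ∀ z y t, (∀ a ∈ z :: y :: t, 0 < a) →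
    (letterSeries z - letterSeries y) * Φ (z :: y :: t) =
      letterSeries z * Φ (z :: t) - letterSeries y * Φ (y :: t)

/-- The generating function of the words that avoid `R`, when the weights of the letters, from
the largest letter to the smallest, are the entries of `l`. -/
noncomputable def avoidanceSeries (R : ℕ → ℕ → ℕ → Prop) (l : List ℕ) : ℝ⟦X⟧ :=
  wordSeries l.length (fun a => l.reverse.getD a 0) (WordAvoids R)

theorem avoidanceSeries_single {R : ℕ → ℕ → ℕ → Prop} (hR : ∀ a, ¬ R a a a) {a : ℕ} (ha : 0 < a) :
    (1 - X ^ a) * avoidanceSeries R [a] = 1 := by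
  classical
  have hT : ∀ u : List ℕ, (∀ b ∈ u, b < 1) → (WordAvoids R u ↔ True) := by
    intro u hu
    refine iff_true_intro fun b c d h => ?_
    have hb := hu b (h.subset (by simp))
    have hc := hu c (h.subset (by simp))
    have hd := hu d (h.subset (by simp))
    obtain rfl : b = 0 := by omega
    obtain rfl : c = 0 := by omega
    obtain rfl : d = 0 := by omega
    exact hR 0
  have h1 : avoidanceSeries R [a] = wordSeries 1 (fun _ => a) (fun _ => True) :=
    wordSeries_congr (fun b hb => by
      obtain rfl : b = 0 := by simpa using hb
      simp) hT
  have h2 := wordSeries_eq (K := 1) (e := fun _ => a) (fun _ _ => ha) (fun _ => True)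
  simp only [Finset.sum_range_one, if_true] at h2
  rw [h1]
  linear_combination h2

theorem isAvoidanceFamily_avoidanceSeries {R : ℕ → ℕ → ℕ → Prop} (hR : ∀ a, ¬ R a a a)
    (hrec : ∀ (k : ℕ) (e : ℕ → ℕ), (∀ a < k + 2, 0 < e a) →
      (letterSeries (e k) - letterSeries (e (k + 1))) * wordSeries (k + 2) e (WordAvoids R) =
        letterSeries (e k) * wordSeries (k + 1) e (WordAvoids R) -
        letterSeries (e (k + 1)) * wordSeries (k + 1) (Function.update e k (e (k + 1)))
          (WordAvoids R)) :
    IsAvoidanceFamily (avoidanceSeries R) := by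
  refine ⟨fun a ha => avoidanceSeries_single hR ha, fun z y t ht => ?_⟩
  have h := hrec t.length (fun a => (z :: y :: t).reverse.getD a 0) fun a ha => ?_
  · have hk : (z :: y :: t).reverse.getD t.length 0 = y := by
      simp [List.getD_eq_getElem?_getD]
    have hk' : (z :: y :: t).reverse.getD (t.length + 1) 0 = z := by
      simp [List.getD_eq_getElem?_getD]
    have hlt : ∀ a < t.length, ∀ l : List ℕ, (t.reverse ++ l).getD a 0 = t.reverse.getD a 0 := by
      intro a ha l
      rw [List.getD_append _ _ _ _ (by simpa using ha)]
    have e1 : wordSeries (t.length + 1) (fun a => (z :: y :: t).reverse.getD a 0)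
        (WordAvoids R) = avoidanceSeries R (y :: t) := by
      refine wordSeries_congr (fun a ha => ?_) fun _ _ => Iff.rfl
      rw [List.reverse_cons, List.getD_append]
      simpa using ha
    have e2 : wordSeries (t.length + 1) (Function.update
        (fun a => (z :: y :: t).reverse.getD a 0) t.length z)
        (WordAvoids R) = avoidanceSeries R (z :: t) := by
      refine wordSeries_congr (fun a ha => ?_) fun _ _ => Iff.rfl
      rcases Nat.lt_succ_iff_lt_or_eq.1 ha with ha | rfl
      · rw [Function.update_of_ne ha.ne]
        simp only [List.reverse_cons, List.append_assoc, hlt a ha]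
      · simp [List.getD_eq_getElem?_getD]
    simp only [hk, hk', e1, e2] at h
    have e3 : wordSeries (t.length + 2) (fun a => (z :: y :: t).reverse.getD a 0)
        (WordAvoids R) = avoidanceSeries R (z :: y :: t) := rfl
    rw [e3] at h
    linear_combination -h
  · have hlen : a < (z :: y :: t).reverse.length := by simpa using ha

    rw [List.getD_eq_getElem _ _ hlen]
    exact ht _ (List.mem_reverse.1 (List.getElem_mem hlen))

theorem isAvoidanceFamily_increasing : IsAvoidanceFamily (avoidanceSeries Increasing) :=
  isAvoidanceFamily_avoidanceSeries (fun _ h => lt_irrefl _ h.1) fun _ _ => increasing_recurrence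

theorem isAvoidanceFamily_descentBelow : IsAvoidanceFamily (avoidanceSeries DescentBelow) :=
  isAvoidanceFamily_avoidanceSeries (fun _ h => lt_irrefl _ h.1) fun _ _ =>
    descentBelow_recurrence

namespace IsAvoidanceFamily

variable {Φ : List ℕ → ℝ⟦X⟧}

/-- Exchanging `z` and `y` changes the sign of both sides of the recurrence. -/
theorem swap (hΦ : IsAvoidanceFamily Φ) {z y : ℕ} {t : List ℕ} (hp : ∀ a ∈ z :: y :: t, 0 < a)
    (hzy : z ≠ y) : Φ (z :: y :: t) = Φ (y :: z :: t) := by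
  have h1 := hΦ.recurrence z y t hp
  have h2 := hΦ.recurrence y z t (fun a ha => hp a (by simp at ha ⊢; tauto))
  refine mul_left_cancel₀ (letterSeries_sub_ne_zero (hp z (by simp)) (hp y (by simp)) hzy) ?_
  linear_combination h1 + h2

/-- Apply the recurrence to the first two entries on both sides, and once more to what remains;
`swap` identifies the two terms that lack `x`. -/
theorem swap_second (hΦ : IsAvoidanceFamily Φ) {x a b : ℕ} {q : List ℕ}
    (hp : ∀ c ∈ x :: a :: b :: q, 0 < c) (hn : (x :: a :: b :: q).Nodup) :
    Φ (x :: a :: b :: q) = Φ (x :: b :: a :: q) := by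
  simp only [List.nodup_cons, List.mem_cons, not_or] at hn
  simp only [List.mem_cons, forall_eq_or_imp] at hp
  obtain ⟨hx, ha, hb, hq⟩ := hp
  obtain ⟨⟨hxa, hxb, -⟩, ⟨hab, -⟩, -⟩ := hn
  have hr : ∀ z y t, 0 < z → 0 < y → (∀ c ∈ t, 0 < c) →
      (letterSeries z - letterSeries y) * Φ (z :: y :: t) =
        letterSeries z * Φ (z :: t) - letterSeries y * Φ (y :: t) := by
    intro z y t hz hy ht
    refine hΦ.recurrence z y t ?_
    simp only [List.mem_cons, forall_eq_or_imp]
    exact ⟨hz, hy, ht⟩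
  have hbq : ∀ c ∈ b :: q, 0 < c := by simpa using ⟨hb, hq⟩
  have haq : ∀ c ∈ a :: q, 0 < c := by simpa using ⟨ha, hq⟩
  have hs : Φ (a :: b :: q) = Φ (b :: a :: q) :=
    hΦ.swap (by simpa using ⟨ha, hb, hq⟩) hab
  have h1 := hr x a (b :: q) hx ha hbq
  have h2 := hr x b (a :: q) hx hb haq
  have h3 := hr x b q hx hb hq
  have h4 := hr x a q hx ha hq
  have h5 := hr a b q ha hb hq
  have n1 := letterSeries_sub_ne_zero hx ha hxa
  have n2 := letterSeries_sub_ne_zero hx hb hxb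
  rw [← hs] at h2
  refine mul_left_cancel₀ (mul_ne_zero n1 n2) ?_
  linear_combination (letterSeries x - letterSeries b) * h1 -
    (letterSeries x - letterSeries a) * h2 + letterSeries x * h3 - letterSeries x * h4
    - letterSeries x * h5

theorem perm (hΦ : IsAvoidanceFamily Φ) {l l' : List ℕ} (h : l.Perm l') (hp : ∀ a ∈ l, 0 < a)
    (hn : l.Nodup) : Φ l = Φ l' := by
  induction hm : l.length using Nat.strong_induction_on generalizing l l' with
  | _ m ih =>
  have hcons : ∀ (x : ℕ) (s s' : List ℕ), s.Perm s' → (∀ a ∈ x :: s, 0 < a) → (x :: s).Nodup →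
      (x :: s).length = m → Φ (x :: s) = Φ (x :: s') := by
    -- With the first two entries fixed, the recurrence reduces the claim to shorter lists.
    have hsame : ∀ (x a : ℕ) (s s' : List ℕ), s.Perm s' → (∀ c ∈ x :: a :: s, 0 < c) →
        (x :: a :: s).Nodup → (x :: a :: s).length = m → Φ (x :: a :: s) = Φ (x :: a :: s') := by
      intro x a s s' hs hp hn hm
      have hp' : ∀ c ∈ x :: a :: s', 0 < c := fun c hc =>
        hp c (((hs.cons a).cons x).mem_iff.2 hc)
      have hxa : x ≠ a := fun h => by simp [h] at hn
      have e1 := hΦ.recurrence x a s hp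
      have e2 := hΦ.recurrence x a s' hp'
      have hp1 : ∀ c ∈ x :: s, 0 < c := fun c hc => hp c (by simp at hc ⊢; tauto)
      have hn1 : (x :: s).Nodup := hn.sublist (by simp)
      rw [← ih (s.length + 1) (by simp at hm; omega) (hs.cons x) hp1 hn1 (by simp),
        ← ih (s.length + 1) (by simp at hm; omega) (hs.cons a)
          (fun c hc => hp c (List.mem_cons_of_mem x hc)) (List.nodup_cons.1 hn).2 (by simp)] at e2
      refine mul_left_cancel₀ (letterSeries_sub_ne_zero (hp x (by simp)) (hp a (by simp)) hxa) ?_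
      rw [e1, e2]
    intro x s s' hs hp hn hm
    match s, s', hs with
    | [], s', hs => rw [List.nil_perm.1 hs]
    | a :: s, [], hs => exact absurd hs.length_eq (by simp)
    | a :: s, b :: s', hs =>
      by_cases hab : a = b
      · subst hab
        exact hsame x a s s' ((List.perm_cons a).1 hs) hp hn hm
      -- With different second entries, bring `b` to third place, exchange it with `a`, and
      -- rearrange the tail again.
      · have hb : b ∈ s := by
          have : b ∈ a :: s := hs.mem_iff.2 (by simp)
          simpa [Ne.symm hab] using this
        have h1 : s.Perm (b :: s.erase b) := List.perm_cons_erase hb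
        have h2 : s'.Perm (a :: s.erase b) := by
          refine (List.perm_cons b).1 (hs.symm.trans ?_)
          exact (h1.cons a).trans (List.Perm.swap b a _)
        have hperm := (h1.cons a).cons x
        have hperm' := (hs.cons x)
        rw [hsame x a s _ h1 hp hn hm, hΦ.swap_second (fun c hc => hp c (hperm.mem_iff.2 hc))
          (hperm.nodup_iff.1 hn)]
        exact (hsame x b s' _ h2 (fun c hc => hp c (hperm'.mem_iff.2 hc))
          (hperm'.nodup_iff.1 hn) (by rw [← hm]; exact hperm'.length_eq.symm)).symm
  match l, l', h with
  | [], l', h => rw [List.nil_perm.1 h]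
  | x :: s, [], h => exact absurd h.length_eq (by simp)
  | x :: s, y :: s', h =>
    by_cases hxy : x = y
    · subst hxy
      exact hcons x s s' ((List.perm_cons x).1 h) hp hn hm
    · have hy : y ∈ s := by
        have : y ∈ x :: s := h.mem_iff.2 (by simp)
        simpa [Ne.symm hxy] using this
      have h1 : s.Perm (y :: s.erase y) := List.perm_cons_erase hy
      have h2 : s'.Perm (x :: s.erase y) := by
        refine (List.perm_cons y).1 (h.symm.trans ?_)
        exact (h1.cons x).trans (List.Perm.swap y x _)
      have hperm := h1.cons x
      rw [hcons x s _ h1 hp hn hm, hΦ.swap (fun c hc => hp c (hperm.mem_iff.2 hc)) hxy]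
      exact (hcons y s' _ h2 (fun c hc => hp c (h.mem_iff.2 hc)) (h.nodup_iff.1 hn)
        (by rw [← hm]; exact h.length_eq.symm)).symm

end IsAvoidanceFamily

/-! ### Absolute convergence and values of power series -/

/-- Absolute convergence of the power series `f` at `ρ`. -/
def ConvergesAbsAt (ρ : ℝ) (f : ℝ⟦X⟧) : Prop := Summable fun n => ‖coeff n f * ρ ^ n‖

/-- The value at `y` of the power series `f`. -/
noncomputable def valueAt (y : ℝ) (f : ℝ⟦X⟧) : ℝ := ∑' n, coeff n f * y ^ n

namespace ConvergesAbsAt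

variable {ρ : ℝ} {f g : ℝ⟦X⟧}

theorem mono {y : ℝ} (hf : ConvergesAbsAt ρ f) (hy : 0 ≤ y) (hρ : y ≤ ρ) : ConvergesAbsAt y f := by
  refine Summable.of_nonneg_of_le (fun _ => norm_nonneg _) (fun n => ?_) hf
  rw [norm_mul, norm_mul, norm_pow, norm_pow, Real.norm_of_nonneg hy,
    Real.norm_of_nonneg (hy.trans hρ)]
  gcongr

theorem X_pow (ρ : ℝ) (i : ℕ) : ConvergesAbsAt ρ (X ^ i) :=
  summable_of_ne_finset_zero (s := {i}) fun n hn => by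
    simp [coeff_X_pow, Finset.notMem_singleton.1 hn]

theorem one (ρ : ℝ) : ConvergesAbsAt ρ 1 := by
  simpa using X_pow ρ 0

theorem sub (hf : ConvergesAbsAt ρ f) (hg : ConvergesAbsAt ρ g) : ConvergesAbsAt ρ (f - g) := by
  refine Summable.of_nonneg_of_le (fun _ => norm_nonneg _) (fun n => ?_) (Summable.add hf hg)
  rw [map_sub, sub_mul]
  exact norm_sub_le _ _

theorem coeff_mul_eq (f g : ℝ⟦X⟧) (ρ : ℝ) (n : ℕ) : coeff n (f * g) * ρ ^ n =
    ∑ kl ∈ Finset.HasAntidiagonal.antidiagonal n, (coeff kl.1 f * ρ ^ kl.1) * (coeff kl.2 g * ρ ^ kl.2) := by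
  rw [coeff_mul, Finset.sum_mul]
  refine Finset.sum_congr rfl fun kl hkl => ?_
  rw [← Finset.HasAntidiagonal.mem_antidiagonal.1 hkl, pow_add]
  ring

theorem mul (hf : ConvergesAbsAt ρ f) (hg : ConvergesAbsAt ρ g) : ConvergesAbsAt ρ (f * g) := by
  unfold ConvergesAbsAt
  simp only [coeff_mul_eq]
  exact summable_norm_sum_mul_antidiagonal_of_summable_norm (f := fun n => coeff n f * ρ ^ n)
    (g := fun n => coeff n g * ρ ^ n) hf hg

theorem C_mul (a : ℝ) (hf : ConvergesAbsAt ρ f) : ConvergesAbsAt ρ (C a * f) := by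
  unfold ConvergesAbsAt
  simp only [coeff_C_mul, mul_assoc, norm_mul a]
  exact Summable.mul_left _ hf

theorem valueAt_sub (hf : ConvergesAbsAt ρ f) (hg : ConvergesAbsAt ρ g) :
    valueAt ρ (f - g) = valueAt ρ f - valueAt ρ g := by
  unfold valueAt
  rw [← hf.of_norm.tsum_sub hg.of_norm]
  simp only [map_sub, sub_mul]

theorem valueAt_mul (hf : ConvergesAbsAt ρ f) (hg : ConvergesAbsAt ρ g) :
    valueAt ρ (f * g) = valueAt ρ f * valueAt ρ g := by
  unfold valueAt
  rw [tsum_mul_tsum_eq_tsum_sum_antidiagonal_of_summable_norm (f := fun n => coeff n f * ρ ^ n)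
    (g := fun n => coeff n g * ρ ^ n) hf hg]
  simp only [coeff_mul_eq]

end ConvergesAbsAt

theorem valueAt_X_pow (y : ℝ) (i : ℕ) : valueAt y (X ^ i) = y ^ i := by
  unfold valueAt
  rw [tsum_eq_single i fun n hn => by simp [coeff_X_pow, hn]]
  simp

theorem valueAt_one (y : ℝ) : valueAt y 1 = 1 := by
  simpa using valueAt_X_pow y 0

theorem valueAt_C_mul (y a : ℝ) (f : ℝ⟦X⟧) : valueAt y (C a * f) = a * valueAt y f := by
  unfold valueAt
  simp only [coeff_C_mul, mul_assoc, tsum_mul_left]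

theorem sum_range_norm_X_pow_mul_le {ρ : ℝ} (hρ : 0 ≤ ρ) (f : ℝ⟦X⟧) (i N : ℕ) :
    ∑ n ∈ Finset.range N, ‖coeff n (X ^ i * f) * ρ ^ n‖ ≤
      ρ ^ i * ∑ n ∈ Finset.range N, ‖coeff n f * ρ ^ n‖ := by
  induction i with
  | zero => simp
  | succ i ih =>
    rw [pow_succ' X, mul_assoc, pow_succ' ρ, mul_assoc]
    refine le_trans ?_ (mul_le_mul_of_nonneg_left ih hρ)
    cases N with
    | zero => simp
    | succ N =>
      rw [Finset.sum_range_succ', Finset.mul_sum]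
      simp only [coeff_succ_X_mul, coeff_zero_X_mul, zero_mul, norm_zero, add_zero]
      rw [Finset.sum_range_succ]
      refine le_add_of_le_of_nonneg (Finset.sum_le_sum fun n _ => le_of_eq ?_) (by positivity)
      rw [pow_succ', ← mul_assoc, mul_comm _ ρ, mul_assoc, norm_mul ρ, Real.norm_of_nonneg hρ]

/-- The partial sums `S` of the absolute series of `f` satisfy `S ≤ G + q S`, where `G` is the
absolute sum of `g` and `q < 1` the quantity in `hab`. So they are bounded by `G / (1 - q)`. -/
theorem ConvergesAbsAt.of_mul_eq {ρ : ℝ} (hρ : 0 ≤ ρ) {f g : ℝ⟦X⟧} {a b : ℝ} {i j : ℕ}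
    (hab : |a| * ρ ^ i + |b| * ρ ^ j < 1) (hg : ConvergesAbsAt ρ g)
    (h : (1 - C a * X ^ i - C b * X ^ j) * f = g) : ConvergesAbsAt ρ f := by
  have hf : ∀ n, coeff n f =
      coeff n g + a * coeff n (X ^ i * f) + b * coeff n (X ^ j * f) := by
    intro n
    have : f = g + C a * (X ^ i * f) + C b * (X ^ j * f) := by
      rw [← h]
      ring
    conv_lhs => rw [this]
    simp only [map_add, coeff_C_mul]
  refine summable_of_sum_range_le (c := (∑' n, ‖coeff n g * ρ ^ n‖) /
    (1 - (|a| * ρ ^ i + |b| * ρ ^ j))) (fun _ => norm_nonneg _) fun N => ?_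
  rw [le_div_iff₀ (by linarith)]
  have h1 : ∑ n ∈ Finset.range N, ‖coeff n f * ρ ^ n‖ ≤
      ∑ n ∈ Finset.range N, ‖coeff n g * ρ ^ n‖ +
        |a| * ∑ n ∈ Finset.range N, ‖coeff n (X ^ i * f) * ρ ^ n‖ +
        |b| * ∑ n ∈ Finset.range N, ‖coeff n (X ^ j * f) * ρ ^ n‖ := by
    rw [Finset.mul_sum, Finset.mul_sum, ← Finset.sum_add_distrib, ← Finset.sum_add_distrib]
    refine Finset.sum_le_sum fun n _ => ?_
    rw [hf n, add_mul, add_mul, mul_assoc, mul_assoc, ← Real.norm_eq_abs, ← Real.norm_eq_abs,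
      ← norm_mul, ← norm_mul]
    exact norm_add₃_le
  have h2 : ∑ n ∈ Finset.range N, ‖coeff n g * ρ ^ n‖ ≤ ∑' n, ‖coeff n g * ρ ^ n‖ :=
    hg.sum_le_tsum _ fun _ _ => norm_nonneg _
  have h3 := mul_le_mul_of_nonneg_left (sum_range_norm_X_pow_mul_le hρ f i N) (abs_nonneg a)
  have h4 := mul_le_mul_of_nonneg_left (sum_range_norm_X_pow_mul_le hρ f j N) (abs_nonneg b)
  linarith

theorem ConvergesAbsAt.of_factors_mul_eq {ρ : ℝ} (hρ : 0 ≤ ρ) {f g : ℝ⟦X⟧} {d i j : ℕ}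
    (hd : ρ ^ d < 1) (hij : ρ ^ i + ρ ^ j < 1) (hg : ConvergesAbsAt ρ g)
    (h : (1 - X ^ d) * (1 - X ^ i - X ^ j) * f = g) : ConvergesAbsAt ρ f := by
  have h1 : ConvergesAbsAt ρ ((1 - X ^ i - X ^ j) * f) :=
    .of_mul_eq hρ (a := 1) (b := 0) (i := d) (j := 0) (by simpa using hd) hg
      (by rw [← h]; simp; ring)
  exact .of_mul_eq hρ (a := 1) (b := 1) (i := i) (j := j) (by simpa using hij) h1 (by simp)

/-- The coefficients of a power series whose product with `1 - r X` converges beyond `1 / r`. -/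
theorem tendsto_coeff_mul_pow {r y : ℝ} (hry : r * y = 1) {f : ℝ⟦X⟧}
    (h : ConvergesAbsAt y ((1 - C r * X) * f)) :
    Filter.Tendsto (fun n => coeff n f * y ^ n) Filter.atTop
      (nhds (valueAt y ((1 - C r * X) * f))) := by
  -- Since `r y = 1`, the terms of `(1 - r X) f` at `y` are the successive differences of `coeff n f
  -- * y ^ n`, and the sum telescopes.
  have hs : ∀ n, coeff n f * y ^ n =
      ∑ m ∈ Finset.range (n + 1), coeff m ((1 - C r * X) * f) * y ^ m := by
    intro n
    have h0 : (1 - C r * X) * f = f - C r * (X * f) := by ring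
    rw [h0]
    induction n with
    | zero => simp
    | succ n ih =>
      rw [Finset.sum_range_succ, ← ih, map_sub, coeff_C_mul, coeff_succ_X_mul, pow_succ]
      linear_combination (coeff n f * y ^ n) * hry
  simp only [hs]
  exact (h.of_norm.hasSum.tendsto_sum_nat).comp (Filter.tendsto_add_atTop_nat 1)

/-- The radius `13 / 20` lies between the root of `x + x ^ 2 = 1`, about 0.618, and that of `x + x ^
3 = 1`, about 0.682. It thus separates the pair `{1, 2}` from all the others. -/
theorem pow_add_pow_lt_one {i j : ℕ} (hi : 0 < i) (hj : 3 ≤ j) :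
    (13 / 20 : ℝ) ^ i + (13 / 20 : ℝ) ^ j < 1 := by
  have h1 : (13 / 20 : ℝ) ^ i ≤ (13 / 20 : ℝ) ^ 1 :=
    pow_le_pow_of_le_one (by norm_num) (by norm_num) hi
  have h2 : (13 / 20 : ℝ) ^ j ≤ (13 / 20 : ℝ) ^ 3 :=
    pow_le_pow_of_le_one (by norm_num) (by norm_num) hj
  norm_num at h1 h2
  linarith

/-! ### The dominant singularity -/

namespace IsAvoidanceFamily

variable {Φ : List ℕ → ℝ⟦X⟧}

theorem reduced_recurrence (hΦ : IsAvoidanceFamily Φ) {a d : ℕ} {t : List ℕ} (ha : 0 < a)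
    (ht : ∀ c ∈ t, 0 < c) :
    (1 - X ^ d) * (1 - X ^ a - X ^ (a + d)) * Φ (a :: (a + d) :: t) =
      (1 - X ^ a) * Φ (a :: t) - X ^ d * (1 - X ^ (a + d)) * Φ ((a + d) :: t) := by
  have h := hΦ.recurrence a (a + d) t (by
    simp only [List.mem_cons, forall_eq_or_imp]
    exact ⟨ha, by omega, ht⟩)
  rw [letterSeries_sub] at h
  refine mul_left_cancel₀ (pow_ne_zero a (X_ne_zero (R := ℝ))) ?_
  unfold letterSeries at h
  linear_combination h

/-- By induction on the length: the recurrence divides by `1 - X ^ d` and `1 - X ^ a - X ^ (a + d)`.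
When 1 and 2 are not both present, `a + d ≥ 3`, and both factors are harmless at `13 / 20`. -/
theorem convergesAbsAt (hΦ : IsAvoidanceFamily Φ) {l : List ℕ} (hne : l ≠ [])
    (hp : ∀ a ∈ l, 0 < a) (hn : l.Nodup) (h12 : ¬ (1 ∈ l ∧ 2 ∈ l)) :
    ConvergesAbsAt (13 / 20) (Φ l) := by
  induction hm : l.length using Nat.strong_induction_on generalizing l with
  | _ m ih =>
  match l, hne with
  | [a], _ =>
    have ha := hp a (by simp)
    refine .of_mul_eq (by norm_num) (a := 1) (b := 0) (i := a) (j := 0) ?_ (.one _)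
      (by simpa using hΦ.single a ha)
    simpa using pow_lt_one₀ (by norm_num : (0 : ℝ) ≤ 13 / 20) (by norm_num) ha.ne'
  | z :: y :: t, _ =>
    have hzy : z ≠ y := fun h => by simp [h] at hn
    have key : ∀ a b : ℕ, a < b → (∀ c ∈ a :: b :: t, 0 < c) → ¬ (1 ∈ a :: b :: t ∧ 2 ∈ a :: b :: t) →
        (a :: b :: t).Nodup → (a :: b :: t).length = m →
        ConvergesAbsAt (13 / 20) (Φ (a :: b :: t)) := by
      intro a b hab hp h12 hn hm
      obtain ⟨d, rfl⟩ := Nat.exists_eq_add_of_lt hab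
      have ha := hp a (by simp)
      have h3 : 3 ≤ a + d + 1 := by
        by_contra hlt
        refine h12 ⟨?_, ?_⟩
        · have : a = 1 := by omega
          simp [this]
        · have : a + d + 1 = 2 := by omega
          simp [this]
      have hrec := hΦ.reduced_recurrence (a := a) (d := d + 1) (t := t) ha
        fun c hc => hp c (by simp [hc])
      have c1 : ConvergesAbsAt (13 / 20) (Φ (a :: t)) :=
        ih (t.length + 1) (by simp at hm; omega) (by simp)
          (fun c hc => hp c (by simp at hc ⊢; tauto)) (hn.sublist (by simp))
          (fun h => h12 (by simp at h ⊢; tauto)) (by simp)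
      have c2 : ConvergesAbsAt (13 / 20) (Φ ((a + d + 1) :: t)) :=
        ih (t.length + 1) (by simp at hm; omega) (by simp)
          (fun c hc => hp c (List.mem_cons_of_mem _ hc)) (List.nodup_cons.1 hn).2
          (fun h => h12 ⟨List.mem_cons_of_mem _ h.1, List.mem_cons_of_mem _ h.2⟩) (by simp)
      refine .of_factors_mul_eq (by norm_num) ?_ (pow_add_pow_lt_one ha h3) ?_ hrec
      · exact pow_lt_one₀ (by norm_num) (by norm_num) (by omega)
      · have hX := fun i => ConvergesAbsAt.one (13 / 20 : ℝ) |>.sub (.X_pow (13 / 20 : ℝ) i)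
        exact ((hX _).mul c1).sub (((ConvergesAbsAt.X_pow _ _).mul (hX _)).mul c2)
    rcases Nat.lt_or_gt_of_ne hzy with h | h
    · exact key z y h hp h12 hn hm
    · have hP := List.Perm.swap y z t
      rw [hΦ.swap hp hzy]
      exact key y z h (fun c hc => hp c (hP.mem_iff.2 hc))
        (fun h => h12 (by rwa [hP.mem_iff, hP.mem_iff])) (hP.nodup_iff.1 hn)
        (by rw [← hm, hP.length_eq])

/-- By induction on `S`. Putting the new weight `j` next to 1 makes the recurrence split off one
term that still has 1 and 2, and one without 1, which converges at `13 / 20` and so contributes 0 at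
`y` after multiplication by `1 - r X`. -/
theorem dominant_part (hΦ : IsAvoidanceFamily Φ) {r y : ℝ} (hry : r * y = 1) (hy : y + y ^ 2 = 1)
    (hy0 : 0 < y) {S : List ℕ} (hS : ∀ a ∈ S, 3 ≤ a) (hn : S.Nodup) :
    ConvergesAbsAt (13 / 20) ((1 - C r * X) * Φ (1 :: 2 :: S)) ∧
      valueAt y ((1 - C r * X) * Φ (1 :: 2 :: S)) = 1 / (1 + y ^ 2) *
        (S.map fun j => (1 - y) / ((1 - y ^ (j - 1)) * (1 - y - y ^ j))).prod := by
  have hyρ : y ≤ 13 / 20 := by nlinarith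
  have hX := fun i => ConvergesAbsAt.one (13 / 20 : ℝ) |>.sub (.X_pow (13 / 20 : ℝ) i)
  have vX : ∀ i, valueAt y (1 - X ^ i) = 1 - y ^ i := fun i => by
    rw [ConvergesAbsAt.valueAt_sub (.one _) (.X_pow _ _), valueAt_one, valueAt_X_pow]
  have hr : ConvergesAbsAt (13 / 20) (1 - C r * X) := by
    simpa using (ConvergesAbsAt.one _).sub ((ConvergesAbsAt.X_pow (13 / 20) 1).C_mul r)
  have vr : valueAt y (1 - C r * X) = 0 := by
    have h := ConvergesAbsAt.valueAt_sub (.one y) ((ConvergesAbsAt.X_pow y 1).C_mul r)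
    rw [valueAt_one, valueAt_C_mul, valueAt_X_pow, pow_one, pow_one, hry, sub_self] at h
    exact h
  induction S with
  | nil =>
    have h := hΦ.reduced_recurrence (a := 1) (d := 1) (t := []) one_pos (by simp)
    have h1 := hΦ.single 1 one_pos
    have h2 := hΦ.single 2 two_pos
    have h3 : (1 - X - X ^ 2) * Φ [1, 2] = 1 := by
      refine mul_left_cancel₀ (one_sub_X_pow_ne_zero one_pos) ?_
      linear_combination h + h1 - X * h2
    -- From `r y = 1` and `r - y = 1` follows `1 - X - X ^ 2 = (1 - r X) (1 + y X)`; the second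
    -- factor gives the value `1 / (1 + y ^ 2)` at `y`.
    have hCr : (C r * C y : ℝ⟦X⟧) = 1 := by rw [← map_mul, hry, map_one]
    have hCy : (C r - C y : ℝ⟦X⟧) = 1 := by
      have : r - y = 1 := by
        have : r * (y + y ^ 2) = r := by rw [hy, mul_one]
        linear_combination -this + (1 + y) * hry
      rw [← map_sub, this, map_one]
    have h4 : (1 - C (-y) * X) * ((1 - C r * X) * Φ [1, 2]) = 1 := by
      rw [map_neg]
      linear_combination h3 + (-X * hCy - X ^ 2 * hCr) * Φ [1, 2]
    have hc : ConvergesAbsAt (13 / 20) ((1 - C r * X) * Φ [1, 2]) := by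
      refine .of_mul_eq (by norm_num) (a := -y) (b := 0) (i := 1) (j := 0) ?_ (.one _)
        (by simpa using h4)
      rw [abs_neg, abs_of_pos hy0]
      norm_num
      linarith
    refine ⟨hc, ?_⟩
    have hyc := (ConvergesAbsAt.X_pow y 1).C_mul (-y)
    have h5 := congrArg (valueAt y) h4
    rw [← pow_one (X : ℝ⟦X⟧)] at h5
    rw [ConvergesAbsAt.valueAt_mul ((ConvergesAbsAt.one y).sub hyc)
      (by simpa using hc.mono hy0.le hyρ), ConvergesAbsAt.valueAt_sub (.one _) hyc, valueAt_one,
      valueAt_C_mul, valueAt_X_pow, pow_one, pow_one] at h5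
    have : (1 : ℝ) + y ^ 2 ≠ 0 := by positivity
    simp only [List.map_nil, List.prod_nil, mul_one]
    rw [eq_div_iff this]
    linear_combination h5
  | cons j S ih =>
    obtain ⟨hj, hS⟩ := List.forall_mem_cons.1 hS
    obtain ⟨hjS, hnS⟩ := List.nodup_cons.1 hn
    obtain ⟨ihc, ihv⟩ := ih hS hnS
    have hS1 : ∀ a ∈ S, 0 < a := fun a ha => by have := hS a ha; omega
    have h1S : 1 ∉ S := fun h => by have := hS 1 h; omega
    have h2S : 2 ∉ S := fun h => by have := hS 2 h; omega
    obtain ⟨d, rfl⟩ : ∃ d, j = 1 + d := ⟨j - 1, by omega⟩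
    have hd : d ≠ 0 := by omega
    have hswap : Φ (1 :: 2 :: (1 + d) :: S) = Φ (1 :: (1 + d) :: 2 :: S) := by
      refine hΦ.swap_second ?_ ?_
      · simpa using hS1
      · simp only [List.nodup_cons, List.mem_cons, not_or]
        exact ⟨⟨by omega, by omega, h1S⟩, ⟨by omega, h2S⟩, hjS, hnS⟩
    have h := hΦ.reduced_recurrence (a := 1) (d := d) (t := 2 :: S) one_pos (by simpa using hS1)
    rw [← hswap] at h
    have hQ : ConvergesAbsAt (13 / 20) (Φ ((1 + d) :: 2 :: S)) := by
      refine hΦ.convergesAbsAt (by simp) (by simpa using hS1) ?_ ?_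
      · simp only [List.nodup_cons, List.mem_cons, not_or]
        exact ⟨⟨by omega, hjS⟩, h2S, hnS⟩
      · rintro ⟨h, -⟩
        simp only [List.mem_cons] at h
        rcases h with h | h | h
        · omega
        · omega
        · exact h1S h
    have hG : (1 - X ^ d) * (1 - X ^ 1 - X ^ (1 + d)) *
        ((1 - C r * X) * Φ (1 :: 2 :: (1 + d) :: S)) =
        (1 - X ^ 1) * ((1 - C r * X) * Φ (1 :: 2 :: S)) -
        X ^ d * (1 - X ^ (1 + d)) * ((1 - C r * X) * Φ ((1 + d) :: 2 :: S)) := by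
      linear_combination (1 - C r * X) * h
    have hc2 := ((ConvergesAbsAt.X_pow (13 / 20) d).mul (hX (1 + d))).mul (hr.mul hQ)
    have hc := ConvergesAbsAt.of_factors_mul_eq (by norm_num)
      (pow_lt_one₀ (by norm_num) (by norm_num) hd) (pow_add_pow_lt_one one_pos hj)
      (((hX 1).mul ihc).sub hc2) hG
    refine ⟨hc, ?_⟩
    have hv := congrArg (valueAt y) hG
    have m := fun {f : ℝ⟦X⟧} (hf : ConvergesAbsAt (13 / 20) f) => hf.mono hy0.le hyρ
    have hX2 := (hX 1).sub (.X_pow (13 / 20) (1 + d))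
    rw [ConvergesAbsAt.valueAt_mul ((m (hX d)).mul (m hX2)) (m hc),
      ConvergesAbsAt.valueAt_mul (m (hX d)) (m hX2),
      ConvergesAbsAt.valueAt_sub (m (hX 1)) (.X_pow _ _),
      ConvergesAbsAt.valueAt_sub (m ((hX 1).mul ihc)) (m hc2),
      ConvergesAbsAt.valueAt_mul (m (hX 1)) (m ihc),
      ConvergesAbsAt.valueAt_mul (m ((ConvergesAbsAt.X_pow _ d).mul (hX (1 + d))))
        (m (hr.mul hQ)),
      ConvergesAbsAt.valueAt_mul (m hr) (m hQ), vr, vX, vX, valueAt_X_pow, ihv, pow_one] at hv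
    have n1 : 1 - y ^ d ≠ 0 := by
      have := pow_lt_one₀ hy0.le (by linarith : y < 1) hd
      linarith
    have n2 : 1 - y - y ^ (1 + d) ≠ 0 := by
      have h1 : y ^ (1 + d) < y ^ 2 := pow_lt_pow_right_of_lt_one₀ hy0 (by linarith) (by omega)
      linarith
    rw [List.map_cons, List.prod_cons, Nat.add_sub_cancel_left]
    field_simp
    field_simp at hv
    linear_combination hv

theorem tendsto_coeff (hΦ : IsAvoidanceFamily Φ) {r y : ℝ} (hry : r * y = 1)
    (hy : y + y ^ 2 = 1) (hy0 : 0 < y) {k : ℕ} (hk : 2 ≤ k) {l : List ℕ} (hn : l.Nodup)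
    (hl : ∀ a, a ∈ l ↔ 1 ≤ a ∧ a ≤ k) :
    Filter.Tendsto (fun n => coeff n (Φ l) * y ^ n) Filter.atTop (nhds (1 / (1 + y ^ 2) *
      ∏ j ∈ Finset.Icc 3 k, (1 - y) / ((1 - y ^ (j - 1)) * (1 - y - y ^ j)))) := by
  have hS : ∀ a ∈ (Finset.Icc 3 k).toList, 3 ≤ a := fun a ha => by
    simp at ha
    omega
  have hperm : l.Perm (1 :: 2 :: (Finset.Icc 3 k).toList) := by
    rw [List.perm_ext_iff_of_nodup hn]
    · intro a
      simp only [hl, List.mem_cons, Finset.mem_toList, Finset.mem_Icc]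
      omega
    · simp [Finset.nodup_toList]
  rw [hΦ.perm hperm (fun a ha => by have := (hl a).1 ha; omega) hn]
  obtain ⟨h1, h2⟩ := hΦ.dominant_part hry hy hy0 hS (Finset.nodup_toList _)
  rw [Finset.prod_map_toList] at h2
  rw [← h2]
  exact tendsto_coeff_mul_pow hry (h1.mono hy0.le (by nlinarith))

end IsAvoidanceFamily

/-! ### From compositions and the six patterns to weighted words -/

/-- Three letters that are in the same relative order as the letters of `π`. -/
def PermPattern (π : Equiv.Perm (Fin 3)) (a b c : ℕ) : Prop :=
  ∀ i j : Fin 3, ![a, b, c] i < ![a, b, c] j ↔ π i < π j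

theorem permPattern_cases (π : Equiv.Perm (Fin 3)) :
    (∀ a b c, PermPattern π a b c ↔ a < b ∧ b < c) ∨
    (∀ a b c, PermPattern π a b c ↔ a < c ∧ c < b) ∨
    (∀ a b c, PermPattern π a b c ↔ b < a ∧ a < c) ∨
    (∀ a b c, PermPattern π a b c ↔ b < c ∧ c < a) ∨
    (∀ a b c, PermPattern π a b c ↔ c < a ∧ a < b) ∨
    (∀ a b c, PermPattern π a b c ↔ c < b ∧ b < a) := by
  have h01 : π 0 ≠ π 1 := π.injective.ne (by decide)
  have h02 : π 0 ≠ π 2 := π.injective.ne (by decide)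
  have h12 : π 1 ≠ π 2 := π.injective.ne (by decide)
  have key : ∀ a b c, PermPattern π a b c ↔
      ((a < b ↔ π 0 < π 1) ∧ (a < c ↔ π 0 < π 2) ∧ (b < a ↔ π 1 < π 0) ∧ (b < c ↔ π 1 < π 2) ∧
        (c < a ↔ π 2 < π 0) ∧ (c < b ↔ π 2 < π 1)) := by
    intro a b c
    refine ⟨fun h => ⟨h 0 1, h 0 2, h 1 0, h 1 2, h 2 0, h 2 1⟩, ?_⟩
    rintro ⟨h1, h2, h3, h4, h5, h6⟩ i j
    fin_cases i <;> fin_cases j <;>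
      first
        | exact iff_of_false (lt_irrefl _) (lt_irrefl _)
        | assumption
  simp only [key]
  rcases lt_or_gt_of_ne h01 with h | h <;> rcases lt_or_gt_of_ne h02 with h' | h' <;>
    rcases lt_or_gt_of_ne h12 with h'' | h'' <;>
    first
      | exact absurd (h.trans h'') h'.not_gt
      | exact absurd (h''.trans h) h'.not_gt
      | simp only [h, h', h'', h.not_gt, h'.not_gt, h''.not_gt, iff_true, iff_false]
        first
          | exact Or.inl (by omega)
          | exact Or.inr (Or.inl (by omega))
          | exact Or.inr (Or.inr (Or.inl (by omega)))
          | exact Or.inr (Or.inr (Or.inr (Or.inl (by omega))))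
          | exact Or.inr (Or.inr (Or.inr (Or.inr (Or.inl (by omega)))))
          | exact Or.inr (Or.inr (Or.inr (Or.inr (Or.inr (by omega)))))

theorem compositionContains_iff {n : ℕ} (π : Equiv.Perm (Fin 3)) (c : Composition n) :
    CompositionContains π c ↔ ¬ WordAvoids (PermPattern π) c.blocks := by
  unfold WordAvoids
  push Not
  constructor
  · rintro ⟨f, hf, h⟩
    refine ⟨c.blocksFun (f 0), c.blocksFun (f 1), c.blocksFun (f 2), ?_, ?_⟩
    · rw [List.sublist_iff_exists_fin_orderEmbedding_get_eq]
      refine ⟨OrderEmbedding.ofStrictMono f hf, fun i => ?_⟩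
      fin_cases i <;> rfl
    · intro i j
      rw [← h i j]
      fin_cases i <;> fin_cases j <;> rfl
  · rintro ⟨x, y, z, hs, h⟩
    rw [List.sublist_iff_exists_fin_orderEmbedding_get_eq] at hs
    obtain ⟨f, hf⟩ := hs
    refine ⟨f, f.strictMono, fun i j => ?_⟩
    rw [← h i j]
    have hb : ∀ i, c.blocksFun (f i) = ![x, y, z] i := by
      intro i
      refine (hf i).symm.trans ?_
      fin_cases i <;> rfl
    rw [hb, hb]

/-- The words of sum `n` over `1, …, k` that avoid `R`. -/
def avoidingWords (R : ℕ → ℕ → ℕ → Prop) (k n : ℕ) : Set (List ℕ) :=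
  {l | (∀ b ∈ l, 0 < b ∧ b ≤ k) ∧ l.sum = n ∧ WordAvoids R l}

theorem avoidingCount_eq (π : Equiv.Perm (Fin 3)) (n k : ℕ) :
    avoidingCount π n k = (avoidingWords (PermPattern π) k n).ncard := by
  have himage : Composition.blocks '' avoidingCompositions π n k =
      avoidingWords (PermPattern π) k n := by
    ext l
    simp only [avoidingCompositions, avoidingWords, Set.mem_image, Set.mem_ofPred_eq,
      compositionContains_iff, not_not]
    constructor
    · rintro ⟨c, ⟨h1, h2⟩, rfl⟩
      exact ⟨fun b hb => ⟨c.blocks_pos hb, h1 b hb⟩, c.blocks_sum, h2⟩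
    · rintro ⟨h1, h2, h3⟩
      exact ⟨⟨l, fun {b} hb => (h1 b hb).1, h2⟩, ⟨fun b hb => (h1 b hb).2, h3⟩, rfl⟩
  rw [← himage, avoidingCount, Set.ncard_image_of_injective]
  intro c c' h
  exact Composition.ext h

theorem ncard_avoidingWords_reverse (R : ℕ → ℕ → ℕ → Prop) (k n : ℕ) :
    (avoidingWords R k n).ncard = (avoidingWords (fun a b c => R c b a) k n).ncard := by
  have himage : List.reverse '' avoidingWords R k n =
      avoidingWords (fun a b c => R c b a) k n := by
    ext l
    simp only [avoidingWords, Set.mem_image, Set.mem_ofPred_eq]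
    have hav : ∀ R : ℕ → ℕ → ℕ → Prop, ∀ l, WordAvoids R l →
        WordAvoids (fun a b c => R c b a) l.reverse := by
      intro R l h a b c habc
      exact h c b a (by simpa using habc.reverse)
    constructor
    · rintro ⟨l, ⟨h1, h2, h3⟩, rfl⟩
      exact ⟨by simpa using h1, by simpa using h2, hav _ _ h3⟩
    · rintro ⟨h1, h2, h3⟩
      exact ⟨l.reverse, ⟨by simpa using h1, by simpa using h2, hav _ _ h3⟩, by simp⟩
  rw [← himage, Set.ncard_image_of_injective _ List.reverse_injective]

/-- A bijection `e` from the letters `0, …, k - 1` to the parts `1, …, k` turns sums into weights.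
Allowing a decreasing `e` covers complementation, which does not preserve the sum of a word. -/
theorem ncard_avoidingWords_eq_coeff {R R' : ℕ → ℕ → ℕ → Prop} {k : ℕ} {e e' : ℕ → ℕ}
    (he : ∀ a < k, 0 < e a ∧ e a ≤ k) (he' : ∀ b, 0 < b → b ≤ k → e' b < k ∧ e (e' b) = b)
    (hee : ∀ a < k, e' (e a) = a)
    (hR : ∀ a < k, ∀ b < k, ∀ c < k, (R (e a) (e b) (e c) ↔ R' a b c)) (n : ℕ) :
    ((avoidingWords R k n).ncard : ℝ) = coeff n (avoidanceSeries R' ((List.range k).map e).reverse) := by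
  have h1 : avoidanceSeries R' ((List.range k).map e).reverse =
      wordSeries k e (WordAvoids R') := by
    unfold avoidanceSeries
    simp only [List.length_reverse, List.length_map, List.length_range, List.reverse_reverse]
    refine wordSeries_congr (fun a ha => ?_) fun _ _ => Iff.rfl
    simp [List.getD_eq_getElem?_getD, ha]
  have himage : List.map e '' weightedWords k e (WordAvoids R') n = avoidingWords R k n := by
    ext l
    simp only [avoidingWords, weightedWords, Set.mem_image, Set.mem_ofPred_eq]
    constructor
    · rintro ⟨u, ⟨hu1, hu2, hu3⟩, rfl⟩
      refine ⟨?_, hu2, ?_⟩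
      · intro b hb
        obtain ⟨a, ha, rfl⟩ := List.mem_map.1 hb
        exact he a (hu1 a ha)
      · intro x y z hs
        obtain ⟨l', hl', hl⟩ := List.sublist_map_iff.1 hs
        match l', hl with
        | [a, b, c], hl =>
          simp only [List.map_cons, List.map_nil, List.cons.injEq, and_true] at hl
          obtain ⟨rfl, rfl, rfl⟩ := hl
          rw [hR a (hu1 a (hl'.subset (by simp))) b (hu1 b (hl'.subset (by simp))) c
            (hu1 c (hl'.subset (by simp)))]
          exact hu3 a b c hl'
    · rintro ⟨h1, h2, h3⟩
      have hid : (l.map e').map e = l := by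
        rw [List.map_map]
        exact (List.map_congr_left fun b hb => (he' b (h1 b hb).1 (h1 b hb).2).2).trans
          (List.map_id' l)
      have hlt : ∀ a ∈ l.map e', a < k := by
        intro a ha
        obtain ⟨b, hb, rfl⟩ := List.mem_map.1 ha
        exact (he' b (h1 b hb).1 (h1 b hb).2).1
      refine ⟨l.map e', ⟨hlt, by rw [hid, h2], ?_⟩, hid⟩
      intro a b c hs
      rw [← hR a (hlt a (hs.subset (by simp))) b (hlt b (hs.subset (by simp))) c
        (hlt c (hs.subset (by simp)))]
      exact h3 _ _ _ (hid ▸ hs.map e)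
  rw [h1, wordSeries, coeff_mk, ← himage, Set.InjOn.ncard_image]
  intro u hu v hv huv
  have hinv : ∀ u ∈ weightedWords k e (WordAvoids R') n, (u.map e).map e' = u := by
    intro u hu
    rw [List.map_map]
    exact (List.map_congr_left fun a ha => hee a (hu.1 a ha)).trans (List.map_id' u)
  rw [← hinv u hu, ← hinv v hv, huv]

/-! ### The limit and the constant -/

section Asymptotics

variable {r y : ℝ} {k : ℕ}

/-- The limit of the normalised number of avoiding words. -/
noncomputable def limitConstant (y : ℝ) (k : ℕ) : ℝ := 1 / (1 + y ^ 2) *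
  ∏ j ∈ Finset.Icc 3 k, (1 - y) / ((1 - y ^ (j - 1)) * (1 - y - y ^ j))

theorem tendsto_avoidingWords (hry : r * y = 1) (hy : y + y ^ 2 = 1) (hy0 : 0 < y) (hk : 2 ≤ k)
    {R R' : ℕ → ℕ → ℕ → Prop} (hR' : IsAvoidanceFamily (avoidanceSeries R')) {e e' : ℕ → ℕ}
    (he : ∀ a < k, 0 < e a ∧ e a ≤ k) (he' : ∀ b, 0 < b → b ≤ k → e' b < k ∧ e (e' b) = b)
    (hee : ∀ a < k, e' (e a) = a)
    (hR : ∀ a < k, ∀ b < k, ∀ c < k, (R (e a) (e b) (e c) ↔ R' a b c)) :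
    Filter.Tendsto (fun n => ((avoidingWords R k n).ncard : ℝ) * y ^ n) Filter.atTop
      (nhds (limitConstant y k)) := by
  simp only [ncard_avoidingWords_eq_coeff he he' hee hR]
  refine hR'.tendsto_coeff hry hy hy0 hk ?_ fun a => ?_
  · rw [List.nodup_reverse]
    refine List.Nodup.map_on (fun a ha b hb hab => ?_) List.nodup_range
    rw [← hee a (List.mem_range.1 ha), hab, hee b (List.mem_range.1 hb)]
  · simp only [List.mem_reverse, List.mem_map, List.mem_range]
    constructor
    · rintro ⟨b, hb, rfl⟩
      exact he b hb
    · rintro ⟨h1, h2⟩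
      exact ⟨e' a, he' a h1 h2⟩

theorem tendsto_avoidingWords_succ (hry : r * y = 1) (hy : y + y ^ 2 = 1) (hy0 : 0 < y)
    (hk : 2 ≤ k) {R R' : ℕ → ℕ → ℕ → Prop} (hR' : IsAvoidanceFamily (avoidanceSeries R'))
    (hR : ∀ a b c, R (a + 1) (b + 1) (c + 1) ↔ R' a b c) :
    Filter.Tendsto (fun n => ((avoidingWords R k n).ncard : ℝ) * y ^ n) Filter.atTop
      (nhds (limitConstant y k)) :=
  tendsto_avoidingWords hry hy hy0 hk hR' (e := fun a => a + 1) (e' := fun b => b - 1)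
    (fun a ha => ⟨by omega, by omega⟩) (fun b h0 h1 => ⟨by omega, by omega⟩)
    (fun a ha => by omega) fun a _ b _ c _ => hR a b c

theorem tendsto_avoidingWords_complement (hry : r * y = 1) (hy : y + y ^ 2 = 1) (hy0 : 0 < y)
    (hk : 2 ≤ k) {R R' : ℕ → ℕ → ℕ → Prop} (hR' : IsAvoidanceFamily (avoidanceSeries R'))
    (hR : ∀ a < k, ∀ b < k, ∀ c < k, (R (k - a) (k - b) (k - c) ↔ R' a b c)) :
    Filter.Tendsto (fun n => ((avoidingWords R k n).ncard : ℝ) * y ^ n) Filter.atTop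
      (nhds (limitConstant y k)) :=
  tendsto_avoidingWords hry hy hy0 hk hR' (e := fun a => k - a) (e' := fun b => k - b)
    (fun a ha => ⟨by omega, by omega⟩) (fun b h0 h1 => ⟨by omega, by omega⟩)
    (fun a ha => by omega) hR

/-- The pattern 123 is handled directly and 321 by complement. The other four are 213 itself, its
reverse, its complement and its reverse complement. -/
theorem tendsto_avoidingCount (hry : r * y = 1) (hy : y + y ^ 2 = 1) (hy0 : 0 < y) (hk : 2 ≤ k)
    (π : Equiv.Perm (Fin 3)) :
    Filter.Tendsto (fun n => (avoidingCount π n k : ℝ) * y ^ n) Filter.atTop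
      (nhds (limitConstant y k)) := by
  simp only [avoidingCount_eq]
  have hI := isAvoidanceFamily_increasing
  have hD := isAvoidanceFamily_descentBelow
  rcases permPattern_cases π with h | h | h | h | h | h
  · refine tendsto_avoidingWords_succ hry hy hy0 hk hI fun a b c => ?_
    rw [h, Increasing]
    omega
  · simp only [ncard_avoidingWords_reverse (PermPattern π)]
    refine tendsto_avoidingWords_complement hry hy hy0 hk hD fun a ha b hb c hc => ?_
    rw [h, DescentBelow]
    omega
  · refine tendsto_avoidingWords_succ hry hy hy0 hk hD fun a b c => ?_
    rw [h, DescentBelow]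
    omega
  · simp only [ncard_avoidingWords_reverse (PermPattern π)]
    refine tendsto_avoidingWords_succ hry hy hy0 hk hD fun a b c => ?_
    rw [h, DescentBelow]
    omega
  · refine tendsto_avoidingWords_complement hry hy hy0 hk hD fun a ha b hb c hc => ?_
    rw [h, DescentBelow]
    omega
  · refine tendsto_avoidingWords_complement hry hy hy0 hk hI fun a ha b hb c hc => ?_
    rw [h, Increasing]
    omega

theorem limitConstant_pos (hy : y + y ^ 2 = 1) (hy0 : 0 < y) : 0 < limitConstant y k := by
  refine mul_pos (by positivity) (Finset.prod_pos fun j hj => ?_)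
  have hj := (Finset.mem_Icc.1 hj).1
  have hy1 : y < 1 := by nlinarith
  have h1 : y ^ (j - 1) < 1 := pow_lt_one₀ hy0.le hy1 (by omega)
  have h2 : y ^ j < y ^ 2 := pow_lt_pow_right_of_lt_one₀ hy0 hy1 (by omega)
  exact div_pos (by linarith) (mul_pos (by linarith) (by linarith))

/-- Both products have the factor `1 / ((1 - y ^ (j - 2)) (1 - y ^ (j - 1)))`. The difference is
therefore `r - 1` times one product, and `r / (r - s) = 1 / (1 + y ^ 2)`. -/
theorem growthConstant_eq (k : ℕ) : growthConstant k = limitConstant (2 / (1 + √5)) k := by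
  have h5 : √5 ^ 2 = 5 := Real.sq_sqrt (by norm_num)
  have h50 : 0 < √5 := by positivity
  unfold growthConstant limitConstant
  dsimp only
  obtain ⟨y, hyd⟩ : ∃ y, y = 2 / (1 + √5) := ⟨_, rfl⟩
  obtain ⟨r, hrd⟩ : ∃ r, r = (1 + √5) / 2 := ⟨_, rfl⟩
  have hs : (1 - √5) / 2 = 1 - r := by rw [hrd]; ring
  have hr2 : r ^ 2 = r + 1 := by rw [hrd]; linear_combination h5 / 4
  have hr1 : 1 < r := by rw [hrd]; nlinarith
  have hyr : y = r⁻¹ := by rw [hyd, hrd, inv_div]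
  rw [hs, ← hyd, ← hrd]
  have hy0 : 0 < y := by rw [hyr]; positivity
  have hry : r * y = 1 := by rw [hyr]; exact mul_inv_cancel₀ (by positivity)
  have hy : y + y ^ 2 = 1 := by
    linear_combination (-y ^ 2) * hr2 + (r * y + 1 - y) * hry
  have hy1 : y < 1 := by nlinarith
  have hz : ∀ m : ℕ, r ^ (-(m : ℤ)) = y ^ m := fun m => by
    rw [zpow_neg, zpow_natCast, hyr, inv_pow]
  have hz2 : r ^ (-2 : ℤ) = y ^ 2 := hz 2
  have hA : ∀ j ∈ Finset.Icc 3 k, (1 - 1 / r) /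
      ((1 - r ^ (1 - (j : ℤ))) * (1 - 1 / r - r ^ (-(j : ℤ)))) =
      (1 - y) / ((1 - y ^ (j - 1)) * (1 - y - y ^ j)) := by
    intro j hj
    have hj := (Finset.mem_Icc.1 hj).1
    have : (1 : ℤ) - j = -((j - 1 : ℕ) : ℤ) := by omega
    rw [this, hz, hz, one_div, ← hyr]
  have hB : ∀ j ∈ Finset.Icc 3 k, (1 - r ^ (-2 : ℤ)) /
      ((1 - r ^ (2 - (j : ℤ))) * (1 - r ^ (-2 : ℤ) - r ^ (-(j : ℤ)))) =
      (1 - y) / ((1 - y ^ (j - 1)) * (1 - y - y ^ j)) := by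
    intro j hj
    have hj := (Finset.mem_Icc.1 hj).1
    obtain ⟨m, rfl⟩ : ∃ m, j = m + 2 := ⟨j - 2, by omega⟩
    have : (2 : ℤ) - (m + 2 : ℕ) = -(m : ℤ) := by omega
    rw [this, hz, hz, hz2]
    have h1 : y ^ m < 1 := pow_lt_one₀ hy0.le hy1 (by omega)
    have h2 : y ^ (m + 1) < 1 := pow_lt_one₀ hy0.le hy1 (by omega)
    have e1 : 1 - y = y ^ 2 := by linear_combination -hy
    have e2 : 1 - y ^ 2 = y := by linear_combination -hy
    have e3 : 1 - y - y ^ (m + 2) = y ^ 2 * (1 - y ^ m) := by rw [e1]; ring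
    have e4 : 1 - y ^ 2 - y ^ (m + 2) = y * (1 - y ^ (m + 1)) := by rw [e2]; ring
    rw [e3, e4, e1, e2, show m + 2 - 1 = m + 1 by omega]
    have n1 : 1 - y ^ m ≠ 0 := by linarith
    have n2 : 1 - y ^ (m + 1) ≠ 0 := by linarith
    field_simp
  rw [Finset.prod_congr rfl hA, Finset.prod_congr rfl hB, ← sub_one_mul, ← mul_assoc]
  congr 1
  have n1 : r - 1 ≠ 0 := by linarith
  have n2 : r - (1 - r) ≠ 0 := by linarith
  have n3 : 1 + y ^ 2 ≠ 0 := by positivity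
  rw [div_mul_eq_mul_div, mul_comm (r - 1), mul_div_mul_right _ _ n1, div_eq_div_iff n2 n3]
  linear_combination (y + r - 1) * hry - y * hr2

end Asymptotics

/-! ### Moduli of the roots -/

/-- Among the roots of the equations `z ^ i + z ^ j = 1`, the inverse of the golden ratio has the
smallest modulus, and it is the only one of this modulus. -/
theorem root_modulus {y : ℝ} (hy : y + y ^ 2 = 1) (hy0 : 0 < y) {i j : ℕ} {z : ℂ} (hi : 1 ≤ i)
    (hij : i < j) (hz : z ^ i + z ^ j = 1) :
    y ≤ ‖z‖ ∧ (‖z‖ = y → i = 1 ∧ j = 2 ∧ z = (y : ℂ)) := by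
  have hy1 : y < 1 := by nlinarith
  have hnorm : 1 ≤ ‖z‖ ^ i + ‖z‖ ^ j := by
    have := norm_add_le (z ^ i) (z ^ j)
    rwa [hz, norm_one, norm_pow, norm_pow] at this
  constructor
  · by_contra! hlt
    have h1 : ‖z‖ ^ i ≤ ‖z‖ ^ 1 :=
      pow_le_pow_of_le_one (norm_nonneg z) (hlt.trans hy1).le hi
    have h2 : ‖z‖ ^ j ≤ ‖z‖ ^ 2 :=
      pow_le_pow_of_le_one (norm_nonneg z) (hlt.trans hy1).le (by omega)
    nlinarith [norm_nonneg z]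
  · intro he
    rw [he] at hnorm
    have h1 : y ^ i ≤ y ^ 1 := pow_le_pow_of_le_one hy0.le hy1.le hi
    have h2 : y ^ j ≤ y ^ 2 := pow_le_pow_of_le_one hy0.le hy1.le (by omega)
    have hi1 : i = 1 := by
      by_contra hne
      have : y ^ i < y ^ 1 := pow_lt_pow_right_of_lt_one₀ hy0 hy1 (by omega)
      linarith
    have hj2 : j = 2 := by
      by_contra hne
      have : y ^ j < y ^ 2 := pow_lt_pow_right_of_lt_one₀ hy0 hy1 (by omega)
      linarith
    subst hi1 hj2
    refine ⟨rfl, rfl, ?_⟩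
    have hyc : (y : ℂ) + (y : ℂ) ^ 2 = 1 := by exact_mod_cast hy
    -- The other root of `z + z ^ 2 = 1` is `-(1 + y)`, whose modulus exceeds `y`.
    have hfac : (z - y) * (z + y + 1) = 0 := by linear_combination hz - hyc
    rcases mul_eq_zero.1 hfac with h | h
    · exact sub_eq_zero.1 h
    · exfalso
      have hzy : z = ((-(y + 1) : ℝ) : ℂ) := by
        push_cast
        linear_combination h
      rw [hzy, Complex.norm_real, Real.norm_eq_abs, abs_neg, abs_of_pos (by linarith)] at he
      linarith

theorem mainTheorem6 :
    (∀ (π : Equiv.Perm (Fin 3)) (k : ℕ), 2 ≤ k →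
      Asymptotics.IsEquivalent Filter.atTop
        (fun n : ℕ => (avoidingCount π n k : ℝ))
        (fun n : ℕ => growthConstant k * ((1 + √5) / 2) ^ n)) ∧
    (((2 / (1 + √5) : ℝ) : ℂ) + ((2 / (1 + √5) : ℝ) : ℂ) ^ 2 = 1 ∧
      ∀ (i j : ℕ) (z : ℂ), 1 ≤ i → i < j → z ^ i + z ^ j = 1 →
        2 / (1 + √5) ≤ ‖z‖ ∧
        (‖z‖ = 2 / (1 + √5) → i = 1 ∧ j = 2 ∧ z = ((2 / (1 + √5) : ℝ) : ℂ))) := by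
  have h5 : √5 ^ 2 = 5 := Real.sq_sqrt (by norm_num)
  have hy0 : 0 < 2 / (1 + √5) := by positivity
  have hy : 2 / (1 + √5) + (2 / (1 + √5)) ^ 2 = 1 := by
    field_simp
    linear_combination -h5
  have hry : (1 + √5) / 2 * (2 / (1 + √5)) = 1 := by field_simp
  refine ⟨fun π k hk => ?_, by exact_mod_cast hy, fun i j z hi hij hz =>
    root_modulus hy hy0 hi hij hz⟩
  rw [growthConstant_eq]
  have hpos := limitConstant_pos (k := k) hy hy0
  refine (Asymptotics.isEquivalent_iff_tendsto_one (.of_forall fun n => by positivity)).2 ?_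
  have h := (tendsto_avoidingCount hry hy hy0 hk π).div_const (limitConstant (2 / (1 + √5)) k)
  rw [div_self hpos.ne'] at h
  refine h.congr fun n => ?_
  have hp : (2 / (1 + √5)) ^ n = (((1 + √5) / 2) ^ n)⁻¹ := by rw [← inv_pow, inv_div]
  rw [Pi.div_apply, hp, mul_comm (limitConstant _ k), ← div_div, ← div_eq_mul_inv]
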